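/- **Setting.** Let $L=\mathbb{R}u$ ($u\in\mathbb{R}^3\setminus\{0\}$) be an oriented line, let $\pi:\mathbb{R}^3\to u^\perp$ be the projection along $L$, and let $\omega(p)=\langle u,p\rangle/\|u\|$ be the signed length of the projection of $p$ onto $L$ (the height of $p$). Let $V\subset\mathbb{R}^3$ be finite such that no two points of $V$ have the same projection and no three points of $A:=\pi(V)$ are collinear; thus $V=A^\omega$ is the point set $A$ of the plane $u^\perp$ lifted by the height function $\omega$. A triangulation of $A$ is a geometric simplicial complex with vertices in $A$ and underlying space $\mathrm{conv}(A)$. Let $\mathcal T_{uv}$ be a geometric simplicial complex in $\mathbb{R}^3$ with vertices in $V$ whose underlying space $P$ satisfies $\pi(P)=\mathrm{conv}(A)$ and meets every line parallel to $L$ in a connected (possibly empty) set. (For example, $\mathcal T_{uv}$ is any triangulation of $V=A^\omega$, i.e. $P=\mathrm{conv}(V)$, or a triangulation of the polyhedron $P$ between two lifted triangulations of $A$, one lying below the other.) Let $\mathcal T_u$ (resp. $\mathcal T_v$) be the set of projections of those simplices of $\mathcal T_{uv}$ that have no point of $P$ below them (resp. above them) in the direction $u$. For distinct tetrahedra $s,t$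 of $\mathcal T_{uv}$ write $s\prec t$ ("$s$ is in front of $t$", seen from the viewpoint at infinity on $L$ in direction $-u$) if some ray in direction $u$ first passes through the interior of $s$ and then through the interior of $t$. **Directed flips.** For a tetrahedron $t$ with vertices in $V$, an *up-flip* with respect to $\omega$ with tetrahedron $t$ turns a triangulation of $A$ that contains the projections of the lower faces of $t$ into the triangulation of $A$ in which these are replaced by the projections of the upper faces of $t$; a *down-flip* does the opposite. A sequence of directed flips is *monotone* if all its flips have the same direction. **Flip algorithm.** Input: $\mathcal T_{uv}$ and a planar triangulation $\mathcal T$ ($\mathcal T_u$ or $\mathcal T_v$). Let $\mathcal Q$ be the set of all tetrahedra of $\mathcal T_{uv}$ and $\mathcal L$ the empty list. While $\mathcal Q\neq\emptyset$: if $\mathcal Q$ contains a removable tetrahedron, choose any one, delete it from $\mathcal Q$, append it to $\mathcal L$, and perform the corresponding flip in $\mathcal T$; otherwise the iteration changes nothing. A tetrahedron whose vertices project to $a,b,c,d$ (in some order) is *removable* if (1) $abc\in\mathcal T$ and $d$ lies in the interior of $abc$ (1-3 flip, inserting $d$); or (2) $abc,abd\in\mathcal T$ and $a,b,c,d$ are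 the vertices of a strictly convex quadrilateral (2-2 flip, replacing $ab$ by $cd$); or (3) $abd,bcd,cad\in\mathcal T$ (3-1 flip, deleting $d$). **Theorem.** Suppose that $\mathcal T_{uv}$ contains no cycle $t_0\prec t_1\prec\dots\prec t_k\prec t_0$ of tetrahedra. Then $\mathcal T_u$ and $\mathcal T_v$ are triangulations of $A$. Whatever choices are made, the flip algorithm with input $\mathcal T_{uv},\mathcal T_u$ terminates; at the end $\mathcal T=\mathcal T_v$, and $\mathcal L$ lists every tetrahedron of $\mathcal T_{uv}$ exactly once and is a monotone sequence of up-flips that transforms $\mathcal T_u$ into $\mathcal T_v$. Likewise, with input $\mathcal T_{uv},\mathcal T_v$ it terminates, and its output is a monotone sequence of down-flips, one for each tetrahedron of $\mathcal T_{uv}$, that transforms $\mathcal T_v$ into $\mathcal T_u$. -/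

import Mathlib

namespace FlipAlg

open Geometry

/-- Euclidean three-space. -/
abbrev Space : Type := EuclideanSpace ℝ (Fin 3)

/-- The plane onto which we project along the line `L = ℝ u` (it is two-dimensional for `u ≠ 0`). -/
abbrev Plane (u : Space) : Type := ((ℝ ∙ u)ᗮ : Submodule ℝ Space)

/-- The parallel projection along the line `L = ℝ u`. -/
noncomputable def proj (u : Space) : Space →L[ℝ] Plane u := ((ℝ ∙ u)ᗮ).orthogonalProjectionOnto

/-- The height function with respect to the oriented line `L = ℝ u`: the signed length of the
projection of `p` onto `L`. A point of space is determined by `proj u p` and `height u p`. -/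
noncomputable def height (u p : Space) : ℝ := inner ℝ u p / ‖u‖

/-- The projection along `L = ℝ u` of a simplex, given by its finite set of vertices. -/
noncomputable def projFace (u : Space) (σ : Finset Space) : Finset (Plane u) :=
  open scoped Classical in σ.image (proj u)

/-- The planar point set `A` below a set `V` of points in space, so that `V` is the lifted point
set of `A`. -/
noncomputable def shadow (u : Space) (V : Finset Space) : Set (Plane u) := proj u '' (V : Set Space)

/-- `V` is a lifted point set over a planar point set in general position: no two points of `V`
have the same projection along `L = ℝ u`, and no three of the projections are collinear. -/
def GeneralPosition (u : Space) (V : Finset Space) : Prop :=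
  Set.InjOn (proj u) (V : Set Space) ∧
  ∀ p ∈ V, ∀ q ∈ V, ∀ r ∈ V, p ≠ q → q ≠ r → p ≠ r →
    ¬ Collinear ℝ ({proj u p, proj u q, proj u r} : Set (Plane u))

/-- `T` is (the set of nonempty simplices of) a triangulation of the point set `A`: a geometric
simplicial complex with vertices in `A` that covers `conv A`. -/
def IsTriangulation {F : Type*} [AddCommGroup F] [Module ℝ F]
    (A : Set F) (T : Set (Finset F)) : Prop :=
  ∃ K : SimplicialComplex ℝ F, K.faces = T ∧ K.vertices ⊆ A ∧ K.space = convexHull ℝ A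

/-- The tetrahedra of a 3d complex. -/
def tetrahedra (K : SimplicialComplex ℝ Space) : Set (Finset Space) :=
  {t | t ∈ K.faces ∧ t.card = 4}

/-- `K` is a 3d triangulation, with vertices in `V`, of a polyhedron that lies between a lower and
an upper section over the convex hull of the projection of `V` along `L = ℝ u`: the polyhedron
projects onto this convex hull, and every line parallel to `L` meets it in a connected set. -/
structure IsTriangulationBetweenSections (u : Space) (V : Finset Space)
    (K : SimplicialComplex ℝ Space) : Prop where
  vertices_subset : K.vertices ⊆ (V : Set Space)
  proj_space : proj u '' K.space = convexHull ℝ (shadow u V)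
  segment_subset : ∀ x ∈ K.space, ∀ y ∈ K.space, proj u x = proj u y → segment ℝ x y ⊆ K.space

/-- Every 3d triangulation of the point set `V` itself is of this kind. -/
theorem IsTriangulationBetweenSections.of_convexHull {u : Space} {V : Finset Space}
    {K : SimplicialComplex ℝ Space} (hV : K.vertices ⊆ (V : Set Space))
    (hK : K.space = convexHull ℝ (V : Set Space)) : IsTriangulationBetweenSections u V K where
  vertices_subset := hV
  proj_space := by
    rw [hK, shadow]
    exact (proj u).toLinearMap.image_convexHull _
  segment_subset x hx y hy _ := by
    rw [hK] at *
    exact (convex_convexHull ℝ _).segment_subset hx hy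

/-- Every triangulation, with vertices in `V`, of the body between the graphs of two functions
`g ≤ h` on the convex hull of the projection of `V` is of this kind. -/
theorem IsTriangulationBetweenSections.of_graphs {u : Space} (hu : u ≠ 0) {V : Finset Space}
    {K : SimplicialComplex ℝ Space} (hV : K.vertices ⊆ (V : Set Space)) (g h : Plane u → ℝ)
    (hgh : ∀ p ∈ convexHull ℝ (shadow u V), g p ≤ h p)
    (hK : K.space = {x | proj u x ∈ convexHull ℝ (shadow u V) ∧
      g (proj u x) ≤ height u x ∧ height u x ≤ h (proj u x)}) :
    IsTriangulationBetweenSections u V K where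
  vertices_subset := hV
  proj_space := by
    have hn : ‖u‖ ≠ 0 := norm_ne_zero_iff.mpr hu
    rw [hK]
    ext p
    constructor
    · rintro ⟨x, hx, rfl⟩
      exact hx.1
    · intro hp
      have hx : proj u ((p : Space) + (g p / ‖u‖) • u) = p := by
        have h1 : proj u (p : Space) = p := Submodule.orthogonalProjectionOnto_mem_subspace_eq_self p
        have h2 : proj u u = 0 :=
          Submodule.orthogonalProjectionOnto_orthogonal_apply_eq_zero
            (Submodule.mem_span_singleton_self u)
        rw [map_add, map_smul, h1, h2, smul_zero, add_zero]
      have hy : height u ((p : Space) + (g p / ‖u‖) • u) = g p := by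
        have h3 : inner ℝ u (p : Space) = 0 := Submodule.mem_orthogonal_singleton_iff_inner_right.mp p.2
        rw [height, inner_add_right, h3, inner_smul_right, real_inner_self_eq_norm_sq]
        field_simp
        ring
      refine ⟨_, ?_, hx⟩
      simp only [Set.mem_ofPred_eq, hx, hy]
      exact ⟨hp, le_rfl, hgh p hp⟩
  segment_subset x hx y hy hxy := by
    rw [hK] at *
    rintro z ⟨a, b, ha, hb, hab, rfl⟩
    have h1 : proj u (a • x + b • y) = proj u x := by
      rw [map_add, map_smul, map_smul, ← hxy, ← add_smul, hab, one_smul]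
    have h2 : height u (a • x + b • y) = a * height u x + b * height u y := by
      simp only [height, inner_add_right, inner_smul_right]
      ring
    obtain ⟨hx1, hx2, hx3⟩ := hx
    obtain ⟨-, hy2, hy3⟩ := hy
    rw [← hxy] at hy2 hy3
    obtain rfl : b = 1 - a := by linarith
    refine ⟨by rw [h1]; exact hx1, ?_, ?_⟩ <;> rw [h1, h2] <;> nlinarith

/-- The simplex `σ` lies on the lower side of the body `P`: nothing of `P` is below `σ`. -/
def OnLowerSide (u : Space) (P : Set Space) (σ : Finset Space) : Prop :=
  ∀ x ∈ convexHull ℝ (σ : Set Space), ∀ y ∈ P, proj u y = proj u x → height u x ≤ height u y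

/-- The simplex `σ` lies on the upper side of the body `P`: nothing of `P` is above `σ`. -/
def OnUpperSide (u : Space) (P : Set Space) (σ : Finset Space) : Prop :=
  ∀ x ∈ convexHull ℝ (σ : Set Space), ∀ y ∈ P, proj u y = proj u x → height u y ≤ height u x

/-- The planar complex `T_u`: the projection of the lower boundary of the 3d triangulation. -/
def lowerTriangulation (u : Space) (K : SimplicialComplex ℝ Space) : Set (Finset (Plane u)) :=
  projFace u '' {σ | σ ∈ K.faces ∧ OnLowerSide u K.space σ}

/-- The planar complex `T_v`: the projection of the upper boundary of the 3d triangulation. -/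
def upperTriangulation (u : Space) (K : SimplicialComplex ℝ Space) : Set (Finset (Plane u)) :=
  projFace u '' {σ | σ ∈ K.faces ∧ OnUpperSide u K.space σ}

/-! ### The in-front/behind relation -/

/-- Seen from the viewpoint at infinity on `L` in direction `-u`, the tetrahedron `s` is in front
of `t`: some ray parallel to `L` first passes through (the interior of) `s` and then through
(the interior of) `t`. -/
def InFront (u : Space) (s t : Finset Space) : Prop :=
  ∃ x ∈ interior (convexHull ℝ (s : Set Space)), ∃ y ∈ interior (convexHull ℝ (t : Set Space)),
    proj u x = proj u y ∧ height u x < height u y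

/-- The tetrahedra of `K` form no cycle `τ₀ ≺ τ₁ ≺ ⋯ ≺ τ₀` with respect to the viewpoint at
infinity on `L = ℝ u`. -/
def AcyclicFrom (u : Space) (K : SimplicialComplex ℝ Space) : Prop :=
  ∀ t, ¬ Relation.TransGen
    (fun a b => a ∈ tetrahedra K ∧ b ∈ tetrahedra K ∧ a ≠ b ∧ InFront u a b) t t

/-! ### Directed flips and monotone sequences -/

/-- The projections of the lower faces (of all dimensions) of a tetrahedron. -/
def lowerFaces (u : Space) (t : Finset Space) : Set (Finset (Plane u)) :=
  projFace u '' {σ | σ.Nonempty ∧ σ ⊆ t ∧ OnLowerSide u (convexHull ℝ (t : Set Space)) σ}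

/-- The projections of the upper faces (of all dimensions) of a tetrahedron. -/
def upperFaces (u : Space) (t : Finset Space) : Set (Finset (Plane u)) :=
  projFace u '' {σ | σ.Nonempty ∧ σ ⊆ t ∧ OnUpperSide u (convexHull ℝ (t : Set Space)) σ}

/-- `T₁` and `T₂` are triangulations of the planar point set below `V`, and `T₂` arises from `T₁`
by the up-flip that belongs to the tetrahedron `t` with vertices in `V`: the lower faces of `t`
appear in `T₁` and are replaced by the upper faces of `t`. -/
structure IsUpFlip (u : Space) (V : Finset Space) (t : Finset Space)
    (T₁ T₂ : Set (Finset (Plane u))) : Prop where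
  left : IsTriangulation (shadow u V) T₁
  right : IsTriangulation (shadow u V) T₂
  subset : t ⊆ V
  card : t.card = 4
  indep : AffineIndependent ℝ ((↑) : t → Space)
  lower : lowerFaces u t ⊆ T₁
  eq : T₂ = (T₁ \ lowerFaces u t) ∪ upperFaces u t

/-- `T₁` and `T₂` are triangulations of the planar point set below `V`, and `T₂` arises from `T₁`
by the down-flip that belongs to the tetrahedron `t` with vertices in `V`: the upper faces of `t`
appear in `T₁` and are replaced by the lower faces of `t`. -/
structure IsDownFlip (u : Space) (V : Finset Space) (t : Finset Space)
    (T₁ T₂ : Set (Finset (Plane u))) : Prop where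
  left : IsTriangulation (shadow u V) T₁
  right : IsTriangulation (shadow u V) T₂
  subset : t ⊆ V
  card : t.card = 4
  indep : AffineIndependent ℝ ((↑) : t → Space)
  upper : upperFaces u t ⊆ T₁
  eq : T₂ = (T₁ \ upperFaces u t) ∪ lowerFaces u t

/-- `FlipSequence R T L T'`: a sequence of flips, all of type `R`, that belong in this order to the
tetrahedra in the list `L`, transforms `T` into `T'`. It is a monotone sequence of directed flips
when `R` is `IsUpFlip u V` or `IsDownFlip u V`. -/
inductive FlipSequence {u : Space}
    (R : Finset Space → Set (Finset (Plane u)) → Set (Finset (Plane u)) → Prop) :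
    Set (Finset (Plane u)) → List (Finset Space) → Set (Finset (Plane u)) → Prop
  | nil (T : Set (Finset (Plane u))) : FlipSequence R T [] T
  | cons (t : Finset Space) (L : List (Finset Space)) (T₁ T₂ T₃ : Set (Finset (Plane u))) :
      R t T₁ T₂ → FlipSequence R T₂ L T₃ → FlipSequence R T₁ (t :: L) T₃

/-! ### The tetrahedra-driven flip algorithm -/

open scoped Classical in
/-- The three cases of a removable tetrahedron `abcd`, seen in the plane. `Flippable T U W` says
that the flip of `T` is possible which destroys the simplex `U` and creates the simplex `W`, where
`U` and `W` together are the four points `a, b, c, d`. -/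
inductive Flippable {u : Space} (T : Set (Finset (Plane u))) :
    Finset (Plane u) → Finset (Plane u) → Prop
  /-- The face `abc` is exposed and contains `d` in its interior (1-3 flip). -/
  | insertion (a b c d : Plane u) : {a, b, c} ∈ T →
      d ∈ interior (convexHull ℝ ({a, b, c} : Set (Plane u))) → Flippable T {a, b, c} {d}
  /-- The faces `abc` and `abd` are exposed and `a, b, c, d` are the vertices of a strictly convex
  quadrilateral (2-2 flip). -/
  | edge (a b c d : Plane u) : {a, b, c} ∈ T → {a, b, d} ∈ T →
      ConvexIndependent ℝ ((↑) : ({a, b, c, d} : Set (Plane u)) → Plane u) →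
      Flippable T {a, b} {c, d}
  /-- The faces `abd`, `bcd` and `cad` are exposed (3-1 flip). -/
  | deletion (a b c d : Plane u) : {a, b, d} ∈ T → {b, c, d} ∈ T → {c, a, d} ∈ T →
      Flippable T {d} {a, b, c}

open scoped Classical in
/-- Perform the flip with support `U ∪ W`: the simplices of the support that contain `U` are
replaced by those that contain `W`. -/
def performFlip {u : Space} (T : Set (Finset (Plane u))) (U W : Finset (Plane u)) :
    Set (Finset (Plane u)) :=
  (T \ {σ | U ⊆ σ ∧ σ ⊂ U ∪ W}) ∪ {σ | W ⊆ σ ∧ σ ⊂ U ∪ W}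

open scoped Classical in
/-- With the current planar triangulation `T`, the tetrahedron `t` is removable, and the
corresponding flip destroys `U` and creates `W`. -/
def RemovableBy {u : Space} (T : Set (Finset (Plane u))) (t : Finset Space)
    (U W : Finset (Plane u)) : Prop :=
  U ∪ W = projFace u t ∧ Flippable T U W

/-- A state of the algorithm: the current planar triangulation `tri`, the set `queue` of remaining
tetrahedra, and the list `out` of the tetrahedra already removed. -/
structure State (u : Space) where
  tri : Set (Finset (Plane u))
  queue : Set (Finset Space)
  out : List (Finset Space)

/-- One iteration of the loop "while the queue is not empty: if a removable tetrahedron exists,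
take one, delete it from the queue, perform its flip and append it to the output". The choice of
the removable tetrahedron is arbitrary; if there is none, the iteration changes nothing. -/
inductive Iteration {u : Space} : State u → State u → Prop
  | flip (s : State u) (t : Finset Space) (U W : Finset (Plane u)) :
      t ∈ s.queue → RemovableBy s.tri t U W →
      Iteration s ⟨performFlip s.tri U W, s.queue \ {t}, s.out ++ [t]⟩
  | idle (s : State u) : s.queue.Nonempty →
      (∀ t ∈ s.queue, ∀ U W, ¬ RemovableBy s.tri t U W) → Iteration s s

/-- The initial state: the planar triangulation `T`, all tetrahedra of `K`, and no output. -/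
def initialState {u : Space} (K : SimplicialComplex ℝ Space) (T : Set (Finset (Plane u))) :
    State u :=
  ⟨T, tetrahedra K, []⟩

/-- The algorithm terminates on the input `K`, `T`: whatever choices are made, the loop is left
after finitely many iterations. -/
def Terminates {u : Space} (K : SimplicialComplex ℝ Space) (T : Set (Finset (Plane u))) : Prop :=
  ¬ ∃ f : ℕ → State u, f 0 = initialState K T ∧ ∀ n, Iteration (f n) (f (n + 1))

/-- `s` is a possible final state of the algorithm on the input `K`, `T`. -/
def IsFinalState {u : Space} (K : SimplicialComplex ℝ Space) (T : Set (Finset (Plane u)))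
    (s : State u) : Prop :=
  Relation.ReflTransGen Iteration (initialState K T) s ∧ s.queue = ∅

/-- On the input `K`, `T` the algorithm terminates, and for all possible choices its output is `T'`
together with a list that contains every tetrahedron of `K` exactly once and that is a sequence of
flips of type `R` from `T` to `T'`. -/
def AlgorithmSucceeds {u : Space}
    (R : Finset Space → Set (Finset (Plane u)) → Set (Finset (Plane u)) → Prop)
    (K : SimplicialComplex ℝ Space) (T T' : Set (Finset (Plane u))) : Prop :=
  Terminates K T ∧
  ∀ s : State u, IsFinalState K T s →
    s.tri = T' ∧ s.out.Nodup ∧ (∀ t, t ∈ s.out ↔ t ∈ tetrahedra K) ∧ FlipSequence R T s.out T'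

end FlipAlg

/-! Fix a vertical vector `e`; the up case is `e = u`, the down case `e = -u`, and one argument
serves both. Inside a tetrahedron `t` the barycentric coordinates change along `e` with constant
slopes. By general position no slope vanishes, so the vertices split into the rising set W = `rising
e t` and the falling set U = `rising (-e) t`, whose projections form the Radon partition of the four
projected points. A face of `t` is a lower face exactly when it does not contain W, and an upper
face exactly when it does not contain U.

The same test works in a complex: a face is on the lower side of `K` iff it contains the rising set
of no tetrahedron of `K` (`lower_iff`). Geometry thereby becomes combinatorics of vertex sets, and
the projected lower side is always a triangulation (`isTriangulation_lowerTri`).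

Call `t` exposed if all its lower facets are on the lower side of `K`. Then every face of `K`
containing U is a face of `t`. Deleting these faces (`removeStar`) removes no tetrahedron but `t`,
leaves a complex between sections, keeps the upper side, and replaces the lower faces of `t` on the
lower side by its upper faces, which is the flip (`Exposed.isFlip`, `Exposed.performFlip_eq`). The
planar removability test recognises exactly the exposed tetrahedra, the flip type being the size of
W (`RemovableBy.exposed`, `Exposed.removableBy`).

Acyclicity gives a frontmost tetrahedron, which is exposed (`AcyclicAlong.exists_exposed`), so the
algorithm never stalls. The current triangulation is always the lower side of the complex that
remains. Once no tetrahedron is left, every face is both lower and upper, so the triangulation is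
the original upper side. -/

namespace FlipAlg

open Geometry

/-! ### Relative interiors of simplices and carriers of points in a complex -/

section OpenHull

variable {E F : Type*} [AddCommGroup E] [Module ℝ E] [AddCommGroup F] [Module ℝ F]

theorem affineIndependent_finset_iff {ι : Type*} {σ : Finset ι} {f : ι → F} :
    AffineIndependent ℝ (fun v : σ => f v) ↔
      ∀ w : ι → ℝ, ∑ v ∈ σ, w v = 0 → ∑ v ∈ σ, w v • f v = 0 → ∀ v ∈ σ, w v = 0 := by
  classical
  constructor
  · intro h w h0 h1 v hv
    refine (affineIndependent_iff.1 h) Finset.univ (fun v => w v) ?_ ?_ ⟨v, hv⟩ (Finset.mem_univ _)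
    · rw [← h0, ← Finset.sum_coe_sort σ w]
    · rw [← h1, ← Finset.sum_coe_sort σ (fun v => w v • f v)]
  · intro h
    rw [affineIndependent_iff_of_fintype]
    intro w h0 h1 v
    rw [Finset.weightedVSub_eq_linear_combination (hw := h0)] at h1
    have := h (fun x => if hx : x ∈ σ then w ⟨x, hx⟩ else 0) ?_ ?_ v v.2
    · simpa using this
    · rw [← Finset.sum_coe_sort, ← h0]
      exact Finset.sum_congr rfl fun i _ => by simp
    · rw [← Finset.sum_coe_sort, ← h1]
      exact Finset.sum_congr rfl fun i _ => by simp

/-- The relative interior of the simplex with vertex set `σ`. -/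
def openHull (σ : Finset E) : Set E :=
  {x | ∃ w : E → ℝ, (∀ v ∈ σ, 0 < w v) ∧ ∑ v ∈ σ, w v = 1 ∧ ∑ v ∈ σ, w v • v = x}

theorem openHull_subset (σ : Finset E) : openHull σ ⊆ convexHull ℝ (σ : Set E) := by
  rintro x ⟨w, h0, h1, h2⟩
  exact Finset.mem_convexHull'.2 ⟨w, fun v hv => (h0 v hv).le, h1, h2⟩

theorem openHull_nonempty {σ : Finset E} (h : σ.Nonempty) : (openHull σ).Nonempty := by
  have hc : (0 : ℝ) < σ.card := by exact_mod_cast h.card_pos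
  refine ⟨_, fun _ => (σ.card : ℝ)⁻¹, fun v _ => by positivity, ?_, rfl⟩
  rw [Finset.sum_const, nsmul_eq_mul, mul_inv_cancel₀ hc.ne']

theorem exists_mem_openHull {s : Finset E} {x : E} (hx : x ∈ convexHull ℝ (s : Set E)) :
    ∃ σ ⊆ s, σ.Nonempty ∧ x ∈ openHull σ := by
  classical
  obtain ⟨w, h0, h1, h2⟩ := Finset.mem_convexHull'.1 hx
  have hz : ∀ v ∈ s, v ∉ s.filter (fun v => 0 < w v) → w v = 0 := by
    intro v hv hv'
    simp only [Finset.mem_filter, not_and, not_lt] at hv'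
    exact le_antisymm (hv' hv) (h0 v hv)
  have e1 : ∑ v ∈ s.filter (fun v => 0 < w v), w v = 1 := by
    rw [← h1]
    exact Finset.sum_subset (Finset.filter_subset _ _) hz
  refine ⟨s.filter (fun v => 0 < w v), Finset.filter_subset _ _, ?_, w, ?_, e1, ?_⟩
  · exact Finset.nonempty_of_sum_ne_zero (e1 ▸ one_ne_zero)
  · intro v hv
    exact (Finset.mem_filter.1 hv).2
  · rw [← h2]
    exact Finset.sum_subset (Finset.filter_subset _ _) fun v hv hv' => by rw [hz v hv hv', zero_smul]

theorem combo_mem_openHull {σ : Finset E} {x y : E} {δ : ℝ} (hx : x ∈ openHull σ)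
    (hy : y ∈ convexHull ℝ (σ : Set E)) (h0 : 0 < δ) (h1 : δ ≤ 1) :
    y + δ • (x - y) ∈ openHull σ := by
  obtain ⟨w, hw0, hw1, rfl⟩ := hx
  obtain ⟨w', hw0', hw1', rfl⟩ := Finset.mem_convexHull'.1 hy
  refine ⟨fun v => (1 - δ) * w' v + δ * w v, fun v hv => ?_, ?_, ?_⟩
  · have := mul_pos h0 (hw0 v hv)
    have := mul_nonneg (sub_nonneg.2 h1) (hw0' v hv)
    linarith
  · rw [Finset.sum_add_distrib, ← Finset.mul_sum, ← Finset.mul_sum, hw1, hw1']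
    ring
  · simp only [add_smul, Finset.sum_add_distrib, mul_smul, ← Finset.smul_sum]
    module

/-- Uniqueness of barycentric coordinates. Extending the weights by zero makes combinations over
different faces of `t` comparable. -/
theorem weight_eq {t : Finset E} (ht : AffineIndependent ℝ ((↑) : t → E)) {σ ρ : Finset E}
    (hσ : σ ⊆ t) (hρ : ρ ⊆ t) {w w' : E → ℝ} (h1 : ∑ v ∈ σ, w v = 1) (h1' : ∑ v ∈ ρ, w' v = 1)
    (h : ∑ v ∈ σ, w v • v = ∑ v ∈ ρ, w' v • v) [DecidableEq E] (v : E) (hv : v ∈ t) :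
    (if v ∈ σ then w v else 0) = if v ∈ ρ then w' v else 0 := by
  have := (affineIndependent_finset_iff (f := id)).1 ht
    (fun v => (if v ∈ σ then w v else 0) - if v ∈ ρ then w' v else 0) ?_ ?_ v hv
  · exact sub_eq_zero.1 this
  · rw [Finset.sum_sub_distrib, Finset.sum_ite_mem, Finset.sum_ite_mem,
      Finset.inter_eq_right.2 hσ, Finset.inter_eq_right.2 hρ, h1, h1', sub_self]
  · simp only [sub_smul, ite_smul, zero_smul, id]
    rw [Finset.sum_sub_distrib, Finset.sum_ite_mem, Finset.sum_ite_mem,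
      Finset.inter_eq_right.2 hσ, Finset.inter_eq_right.2 hρ, h, sub_self]

/-- The point lies in the hull of `σ ∩ s`. Its coordinates with respect to `σ` are unique and all
positive, so no vertex of `σ` can be missing from `s`. -/
theorem subset_of_mem_openHull {K : SimplicialComplex ℝ E} {σ s : Finset E} {x : E}
    (hσ : σ ∈ K.faces) (hs : s ∈ K.faces) (hx : x ∈ openHull σ)
    (hx' : x ∈ convexHull ℝ (s : Set E)) : σ ⊆ s := by
  classical
  have := K.inter_subset_convexHull hσ hs ⟨openHull_subset σ hx, hx'⟩
  rw [← Finset.coe_inter] at this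
  obtain ⟨ρ, hρ, -, w', h0', h1', h2'⟩ := exists_mem_openHull this
  obtain ⟨w, h0, h1, h2⟩ := hx
  intro v hv
  have := weight_eq (K.indep hσ) subset_rfl (hρ.trans Finset.inter_subset_left) h1 h1'
    (h2.trans h2'.symm) v hv
  by_contra hvs
  rw [if_pos hv, if_neg fun h => hvs (Finset.mem_inter.1 (hρ h)).2] at this
  exact (h0 v hv).ne' this

theorem exists_face_openHull {K : SimplicialComplex ℝ E} {x : E} (hx : x ∈ K.space) :
    ∃ σ ∈ K.faces, x ∈ openHull σ := by
  obtain ⟨s, hs, hx⟩ := SimplicialComplex.mem_space_iff.1 hx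
  obtain ⟨σ, hσ, hne, hx⟩ := exists_mem_openHull hx
  exact ⟨σ, K.down_closed hs hσ hne, hx⟩

end OpenHull

/-! ### Barycentric coordinates of a tetrahedron -/

/-- `t` is the vertex set of a nondegenerate tetrahedron. -/
structure IsTetrahedron (t : Finset Space) : Prop where
  indep : AffineIndependent ℝ ((↑) : t → Space)
  card : t.card = 4

/-- The vertices of a tetrahedron as an affine basis of space. -/
noncomputable def IsTetrahedron.basis {t : Finset Space} (ht : IsTetrahedron t) :
    AffineBasis t ℝ Space :=
  ⟨(↑), ht.indep, by
    rw [ht.indep.affineSpan_eq_top_iff_card_eq_finrank_add_one]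
    simp [ht.card]⟩

open scoped Classical in
/-- The barycentric coordinate that belongs to the vertex `v` of the tetrahedron `t`. -/
noncomputable def coord (t : Finset Space) (v : Space) : Space →ᵃ[ℝ] ℝ :=
  if h : IsTetrahedron t ∧ v ∈ t then h.1.basis.coord ⟨v, h.2⟩ else 0

/-- The change of the barycentric coordinate of `v` in direction `e`. -/
noncomputable def slope (e : Space) (t : Finset Space) (v : Space) : ℝ := (coord t v).linear e

open scoped Classical in
/-- The vertices of `t` whose barycentric coordinate increases in direction `e`. -/
noncomputable def rising (e : Space) (t : Finset Space) : Finset Space :=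
  t.filter fun v => 0 < slope e t v

theorem coord_add_smul (t : Finset Space) (v x e : Space) (c : ℝ) :
    coord t v (x + c • e) = coord t v x + c * slope e t v := by
  have := (coord t v).map_vadd x (c • e)
  rw [vadd_eq_add, add_comm, map_smul, vadd_eq_add, smul_eq_mul] at this
  rw [this, slope, add_comm]

theorem slope_neg (e : Space) (t : Finset Space) (v : Space) : slope (-e) t v = - slope e t v := by
  simp [slope]

theorem rising_subset (e : Space) (t : Finset Space) : rising e t ⊆ t := Finset.filter_subset _ _

theorem mem_rising {e : Space} {t : Finset Space} {v : Space} :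
    v ∈ rising e t ↔ v ∈ t ∧ 0 < slope e t v := by
  simp [rising]

namespace IsTetrahedron

variable {t : Finset Space} (ht : IsTetrahedron t) {e x : Space}
include ht

theorem coord_eq {v : Space} (hv : v ∈ t) : coord t v = ht.basis.coord ⟨v, hv⟩ :=
  dif_pos ⟨ht, hv⟩

theorem mem_convexHull_iff :
    x ∈ convexHull ℝ (t : Set Space) ↔ ∀ v ∈ t, 0 ≤ coord t v x := by
  have := ht.basis.convexHull_eq_nonneg_coord
  rw [show Set.range ht.basis = (t : Set Space) from Subtype.range_coe] at this
  rw [this]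
  exact ⟨fun h v hv => by rw [ht.coord_eq hv]; exact h _,
    fun h v => by rw [← ht.coord_eq v.2]; exact h _ v.2⟩

theorem mem_interior_iff :
    x ∈ interior (convexHull ℝ (t : Set Space)) ↔ ∀ v ∈ t, 0 < coord t v x := by
  have := ht.basis.interior_convexHull
  rw [show Set.range ht.basis = (t : Set Space) from Subtype.range_coe] at this
  rw [this]
  exact ⟨fun h v hv => by rw [ht.coord_eq hv]; exact h _,
    fun h v => by rw [← ht.coord_eq v.2]; exact h _ v.2⟩

theorem sum_coord (x : Space) : ∑ v ∈ t, coord t v x = 1 := by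
  rw [← Finset.sum_coe_sort, ← ht.basis.sum_coord_apply_eq_one x]
  exact Finset.sum_congr rfl fun v _ => by rw [ht.coord_eq v.2]

theorem sum_coord_smul (x : Space) : ∑ v ∈ t, coord t v x • v = x := by
  conv_rhs => rw [← ht.basis.linear_combination_coord_eq_self x]
  rw [← Finset.sum_coe_sort]
  exact Finset.sum_congr rfl fun v _ => by rw [ht.coord_eq v.2]; rfl

theorem sum_slope (e : Space) : ∑ v ∈ t, slope e t v = 0 := by
  have h := ht.sum_coord (0 + (1 : ℝ) • e)
  simp only [coord_add_smul, Finset.sum_add_distrib, ht.sum_coord, one_mul] at h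
  linarith

theorem sum_slope_smul (e : Space) : ∑ v ∈ t, slope e t v • v = e := by
  have h := ht.sum_coord_smul (0 + (1 : ℝ) • e)
  simp only [coord_add_smul, Finset.sum_add_distrib, add_smul, ht.sum_coord_smul, one_mul] at h
  simpa using h

theorem coord_combination [DecidableEq Space] {σ : Finset Space} (hσ : σ ⊆ t) {w : Space → ℝ}
    (h1 : ∑ v ∈ σ, w v = 1) (h2 : ∑ v ∈ σ, w v • v = x) {v : Space} (hv : v ∈ t) :
    coord t v x = if v ∈ σ then w v else 0 := by
  have := weight_eq ht.indep hσ subset_rfl h1 (ht.sum_coord x) (h2.trans (ht.sum_coord_smul x).symm)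
    v hv
  rw [this, if_pos hv]

theorem coord_pos {σ : Finset Space} (hσ : σ ⊆ t) (hx : x ∈ openHull σ) {v : Space} (hv : v ∈ σ) :
    0 < coord t v x := by
  classical
  obtain ⟨w, h0, h1, h2⟩ := hx
  rw [ht.coord_combination hσ h1 h2 (hσ hv), if_pos hv]
  exact h0 v hv

theorem coord_eq_zero {σ : Finset Space} (hσ : σ ⊆ t) (hx : x ∈ convexHull ℝ (σ : Set Space))
    {v : Space} (hv : v ∈ t) (hv' : v ∉ σ) : coord t v x = 0 := by
  classical
  obtain ⟨w, h0, h1, h2⟩ := Finset.mem_convexHull'.1 hx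
  rw [ht.coord_combination hσ h1 h2 hv, if_neg hv']

theorem mem_openHull_self (hx : x ∈ interior (convexHull ℝ (t : Set Space))) : x ∈ openHull t :=
  ⟨fun v => coord t v x, ht.mem_interior_iff.1 hx, ht.sum_coord x, ht.sum_coord_smul x⟩

/-- The slopes sum to zero; if none is positive, all vanish, and then so does `e = ∑ slope e t v •
v`. -/
theorem rising_nonempty (he : e ≠ 0) : (rising e t).Nonempty := by
  by_contra h
  have hle : ∀ v ∈ t, slope e t v ≤ 0 := fun v hv => by
    by_contra h'
    exact h ⟨v, mem_rising.2 ⟨hv, not_le.1 h'⟩⟩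
  have h0 := (Finset.sum_eq_zero_iff_of_nonpos hle).1 (ht.sum_slope e)
  apply he
  rw [← ht.sum_slope_smul e]
  exact Finset.sum_eq_zero fun v hv => by rw [h0 v hv, zero_smul]

/-- At a point of `σ` the coordinate of a vertex outside `σ` is zero; if that vertex is rising, any
step down makes it negative. -/
theorem rising_subset_of_sub_mem {σ : Finset Space} (hσ : σ ⊆ t)
    (hx : x ∈ convexHull ℝ (σ : Set Space)) {c : ℝ} (hc : 0 < c)
    (h : x - c • e ∈ convexHull ℝ (t : Set Space)) : rising e t ⊆ σ := by
  intro v hv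
  obtain ⟨hv, hs⟩ := mem_rising.1 hv
  by_contra hvσ
  have := ht.mem_convexHull_iff.1 h v hv
  rw [sub_eq_add_neg, ← neg_smul, coord_add_smul, ht.coord_eq_zero hσ hx hv hvσ] at this
  nlinarith

/-- On a short way down, rising coordinates stay positive because they start positive on `openHull
σ`. The others start nonnegative and strictly increase, as no slope is zero. -/
theorem exists_sub_mem_interior (hs : ∀ v ∈ t, slope e t v ≠ 0) {σ : Finset Space} (hσ : σ ⊆ t)
    (hW : rising e t ⊆ σ) (hx : x ∈ openHull σ) :
    ∃ c : ℝ, 0 < c ∧ x - c • e ∈ interior (convexHull ℝ (t : Set Space)) := by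
  have key : ∀ v ∈ t, ∀ᶠ c in nhdsWithin (0 : ℝ) (Set.Ioi 0), 0 < coord t v x - c * slope e t v := by
    intro v hv
    by_cases hvW : v ∈ rising e t
    · have h0 := ht.coord_pos hσ hx (hW hvW)
      have hcont : Filter.Tendsto (fun c : ℝ => coord t v x - c * slope e t v)
          (nhdsWithin 0 (Set.Ioi 0)) (nhds (coord t v x - 0 * slope e t v)) :=
        tendsto_nhdsWithin_of_tendsto_nhds (Continuous.tendsto (by fun_prop) 0)
      exact hcont.eventually_const_lt (by simpa using h0)
    · have hneg : slope e t v < 0 :=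
        lt_of_le_of_ne (not_lt.1 fun h => hvW (mem_rising.2 ⟨hv, h⟩)) (hs v hv)
      have h0 := ht.mem_convexHull_iff.1
        (convexHull_mono (Finset.coe_subset.2 hσ) (openHull_subset σ hx)) v hv
      filter_upwards [self_mem_nhdsWithin] with c hc
      have := mul_pos_of_neg_of_neg hneg (neg_lt_zero.2 hc)
      nlinarith
  have := (Filter.eventually_all_finset t).2 key
  obtain ⟨c, hc, hc0⟩ := (this.and self_mem_nhdsWithin).exists
  refine ⟨c, hc0, ht.mem_interior_iff.2 fun v hv => ?_⟩
  rw [sub_eq_add_neg, ← neg_smul, coord_add_smul, neg_mul, ← sub_eq_add_neg]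
  exact hc v hv

end IsTetrahedron

/-! ### Vertical directions and general position -/

/-- The vector `e` spans the kernel of the projection along `L = ℝ u`. -/
structure IsVertical (u e : Space) : Prop where
  ne_zero : e ≠ 0
  proj_eq_zero_iff : ∀ x, proj u x = 0 ↔ ∃ c : ℝ, x = c • e

theorem isVertical_self {u : Space} (hu : u ≠ 0) : IsVertical u u where
  ne_zero := hu
  proj_eq_zero_iff x := by
    rw [proj, Submodule.orthogonalProjectionOnto_eq_zero_iff, Submodule.orthogonal_orthogonal,
      Submodule.mem_span_singleton]
    exact exists_congr fun c => eq_comm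

theorem IsVertical.neg {u e : Space} (he : IsVertical u e) : IsVertical u (-e) where
  ne_zero := neg_ne_zero.2 he.ne_zero
  proj_eq_zero_iff x := by
    rw [he.proj_eq_zero_iff]
    exact ⟨fun ⟨c, hc⟩ => ⟨-c, by simp [hc]⟩, fun ⟨c, hc⟩ => ⟨-c, by simp [hc]⟩⟩

theorem IsVertical.proj_self {u e : Space} (he : IsVertical u e) : proj u e = 0 :=
  (he.proj_eq_zero_iff e).2 ⟨1, (one_smul ℝ e).symm⟩

theorem IsVertical.proj_add_smul {u e : Space} (he : IsVertical u e) (x : Space) (c : ℝ) :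
    proj u (x + c • e) = proj u x := by
  rw [map_add, map_smul, he.proj_self, smul_zero, add_zero]

theorem IsVertical.exists_eq_add_smul {u e x y : Space} (he : IsVertical u e)
    (h : proj u y = proj u x) : ∃ c : ℝ, y = x + c • e := by
  obtain ⟨c, hc⟩ := (he.proj_eq_zero_iff (y - x)).1 (by rw [map_sub, h, sub_self])
  exact ⟨c, by rw [← hc, add_sub_cancel]⟩

section General

variable {u e : Space} {V : Finset Space}

theorem GeneralPosition.affineIndependent_proj (hV : GeneralPosition u V) {σ : Finset Space}
    (hσ : σ ⊆ V) (hc : σ.card ≤ 3) : AffineIndependent ℝ (fun v : σ => proj u v) := by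
  classical
  rw [affineIndependent_finset_iff]
  intro w h0 h1
  obtain h | h | h | h : σ.card = 0 ∨ σ.card = 1 ∨ σ.card = 2 ∨ σ.card = 3 := by omega
  · rw [Finset.card_eq_zero.1 h]
    simp
  · obtain ⟨a, rfl⟩ := Finset.card_eq_one.1 h
    simpa using h0
  · obtain ⟨a, b, hab, rfl⟩ := Finset.card_eq_two.1 h
    rw [Finset.sum_pair hab] at h0 h1
    have hb : w b = - w a := by linarith
    have h2 : w a • (proj u a - proj u b) = 0 := by
      rw [← h1, hb]
      module
    have h3 : proj u a - proj u b ≠ 0 :=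
      sub_ne_zero.2 fun h => hab (hV.1 (hσ (by simp)) (hσ (by simp)) h)
    have h4 := (smul_eq_zero.1 h2).resolve_right h3
    simp [hb, h4]
  · obtain ⟨a, b, c, hab, hac, hbc, rfl⟩ := Finset.card_eq_three.1 h
    have h3 := hV.2 a (hσ (by simp)) b (hσ (by simp)) c (hσ (by simp)) hab hbc hac
    rw [← affineIndependent_iff_not_collinear_set, affineIndependent_iff] at h3
    rw [Finset.sum_insert (by simp [hab, hac]), Finset.sum_pair hbc] at h0 h1
    have := h3 Finset.univ ![w a, w b, w c] (by simp [Fin.sum_univ_three]; linarith)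
      (by simpa [Fin.sum_univ_three, add_assoc] using h1)
    have e0 := this 0 (Finset.mem_univ _)
    have e1 := this 1 (Finset.mem_univ _)
    have e2 := this 2 (Finset.mem_univ _)
    simp only [Matrix.cons_val] at e0 e1 e2
    simp [e0, e1, e2]

/-- Hence only tetrahedra can contain two points of one vertical line. -/
theorem GeneralPosition.injOn_convexHull (hV : GeneralPosition u V) {σ : Finset Space}
    (hσ : σ ⊆ V) (hc : σ.card ≤ 3) : Set.InjOn (proj u) (convexHull ℝ (σ : Set Space)) := by
  intro x hx y hy hxy
  obtain ⟨w, -, h1, rfl⟩ := Finset.mem_convexHull'.1 hx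
  obtain ⟨w', -, h1', rfl⟩ := Finset.mem_convexHull'.1 hy
  have := affineIndependent_finset_iff.1 (hV.affineIndependent_proj hσ hc) (fun v => w v - w' v)
    (by rw [Finset.sum_sub_distrib, h1, h1', sub_self]) (by
      simp only [map_sum, map_smul] at hxy
      simp only [sub_smul, Finset.sum_sub_distrib, hxy, sub_self])
  exact Finset.sum_congr rfl fun v hv => by rw [sub_eq_zero.1 (this v hv)]

theorem GeneralPosition.projFace_subset_iff (hV : GeneralPosition u V) {σ τ : Finset Space}
    (hσ : σ ⊆ V) (hτ : τ ⊆ V) : projFace u σ ⊆ projFace u τ ↔ σ ⊆ τ := by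
  classical
  refine ⟨fun h v hv => ?_, fun h => Finset.image_subset_image h⟩
  obtain ⟨w, hw, hwv⟩ := Finset.mem_image.1 (h (Finset.mem_image_of_mem _ hv))
  exact hV.1 (hτ hw) (hσ hv) hwv ▸ hw

theorem coe_projFace (u : Space) (σ : Finset Space) :
    (projFace u σ : Set (Plane u)) = proj u '' (σ : Set Space) := by
  classical
  exact Finset.coe_image

theorem convexHull_projFace (u : Space) (σ : Finset Space) :
    convexHull ℝ (projFace u σ : Set (Plane u)) = proj u '' convexHull ℝ (σ : Set Space) := by
  rw [coe_projFace]
  exact ((proj u).toLinearMap.image_convexHull _).symm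

theorem mem_projFace {σ : Finset Space} {p : Plane u} :
    p ∈ projFace u σ ↔ ∃ v ∈ σ, proj u v = p := by
  classical
  exact Finset.mem_image

theorem GeneralPosition.affineIndependent_projFace (hV : GeneralPosition u V) {σ : Finset Space}
    (hσ : σ ⊆ V) (hc : σ.card ≤ 3) : AffineIndependent ℝ ((↑) : projFace u σ → Plane u) := by
  classical
  refine (affineIndependent_finset_iff (f := id)).2 ?_
  have h := affineIndependent_finset_iff.1 (hV.affineIndependent_proj hσ hc)
  intro w h0 h1 p hp
  have hinj : Set.InjOn (proj u) (σ : Set Space) := hV.1.mono (Finset.coe_subset.2 hσ)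
  rw [projFace, Finset.sum_image hinj] at h0 h1
  obtain ⟨v, hv, rfl⟩ := mem_projFace.1 hp
  exact h (fun v => w (proj u v)) h0 h1 v hv

/-- If the slope at `v` vanished, the other three slopes would sum to zero and combine their
vertices to `e`. Projecting gives an affine dependence between three projected points. -/
theorem GeneralPosition.slope_ne_zero (hV : GeneralPosition u V) (he : IsVertical u e)
    {t : Finset Space} (ht : IsTetrahedron t) (htV : t ⊆ V) : ∀ v ∈ t, slope e t v ≠ 0 := by
  classical
  intro v hv hs
  have h0 := ht.sum_slope e
  have h1 := ht.sum_slope_smul e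
  rw [← Finset.add_sum_erase _ _ hv, hs, zero_add] at h0
  rw [← Finset.add_sum_erase _ _ hv, hs, zero_smul, zero_add] at h1
  have hc : (t.erase v).card ≤ 3 := by rw [Finset.card_erase_of_mem hv, ht.card]
  have := affineIndependent_finset_iff.1
    (hV.affineIndependent_proj ((Finset.erase_subset v t).trans htV) hc) (slope e t) h0 (by
      simp only [← map_smul, ← map_sum, h1, he.proj_self])
  apply he.ne_zero
  rw [← h1]
  exact Finset.sum_eq_zero fun w hw => by rw [this w hw, zero_smul]

theorem GeneralPosition.mem_rising_neg_iff (hV : GeneralPosition u V) (he : IsVertical u e)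
    {t : Finset Space} (ht : IsTetrahedron t) (htV : t ⊆ V) {v : Space} (hv : v ∈ t) :
    v ∈ rising (-e) t ↔ v ∉ rising e t := by
  have := hV.slope_ne_zero he ht htV v hv
  rw [mem_rising, mem_rising, slope_neg, neg_pos]
  simp only [hv, true_and, not_lt]
  exact ⟨le_of_lt, fun h => lt_of_le_of_ne h this⟩

/-- No point of `P` lies below a point of the simplex `σ`, when `e` points upwards. -/
def Lower (e : Space) (P : Set Space) (σ : Finset Space) : Prop :=
  ∀ x ∈ convexHull ℝ (σ : Set Space), ∀ c : ℝ, x + c • e ∈ P → 0 ≤ c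

theorem Lower.mono {P : Set Space} {σ τ : Finset Space} (h : Lower e P σ) (hτ : τ ⊆ σ) :
    Lower e P τ :=
  fun x hx => h x (convexHull_mono (Finset.coe_subset.2 hτ) hx)

/-- A point in the relative interior of the rising set has interior points of `t` directly below it;
conversely, a point of `σ` with a point of `t` below it forces the rising set into `σ`. -/
theorem GeneralPosition.lower_tetrahedron_iff (hV : GeneralPosition u V) (he : IsVertical u e)
    {t : Finset Space} (ht : IsTetrahedron t) (htV : t ⊆ V) {σ : Finset Space} (hσ : σ ⊆ t) :
    Lower e (convexHull ℝ (t : Set Space)) σ ↔ ¬ rising e t ⊆ σ := by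
  constructor
  · intro h hr
    obtain ⟨x, hx⟩ := openHull_nonempty (ht.rising_nonempty he.ne_zero)
    obtain ⟨c, hc, hxc⟩ :=
      ht.exists_sub_mem_interior (hV.slope_ne_zero he ht htV) (rising_subset e t) subset_rfl hx
    have := h x (convexHull_mono (Finset.coe_subset.2 hr) (openHull_subset _ hx)) (-c) (by
      rw [neg_smul, ← sub_eq_add_neg]
      exact interior_subset hxc)
    linarith
  · intro h x hx c hc
    by_contra! hneg
    refine h (ht.rising_subset_of_sub_mem (c := -c) hσ hx (neg_pos.2 hneg) ?_)
    rwa [neg_smul, sub_neg_eq_add]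

/-- Moving `y` slightly towards a relative interior point keeps `y + z` in the open set. Afterwards
the carrier of the point is all of `σ`, so `subset_of_mem_openHull` applies. -/
theorem exists_mem_openHull_perturb {σ : Finset Space} (hne : σ.Nonempty) {y z : Space}
    (hy : y ∈ convexHull ℝ (σ : Set Space)) {O : Set Space} (hO : IsOpen O) (h : y + z ∈ O) :
    ∃ y' ∈ openHull σ, y' + z ∈ O := by
  obtain ⟨x, hx⟩ := openHull_nonempty hne
  have hcont : Filter.Tendsto (fun δ : ℝ => y + δ • (x - y) + z) (nhdsWithin 0 (Set.Ioi 0))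
      (nhds (y + (0 : ℝ) • (x - y) + z)) :=
    tendsto_nhdsWithin_of_tendsto_nhds (Continuous.tendsto (by fun_prop) 0)
  rw [zero_smul, add_zero] at hcont
  have h1 : Set.Ioc (0 : ℝ) 1 ∈ nhdsWithin (0 : ℝ) (Set.Ioi 0) := Ioc_mem_nhdsGT one_pos
  obtain ⟨δ, hδ, hδ1⟩ := ((hcont.eventually_mem (hO.mem_nhds h)).and h1).exists
  exact ⟨_, combo_mem_openHull hx hy hδ1.1 hδ1.2, hδ⟩

end General

/-! ### The lower side of a complex -/

section Complex

variable {u e : Space} {V : Finset Space} {K : SimplicialComplex ℝ Space}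

theorem IsTriangulationBetweenSections.face_subset (hK : IsTriangulationBetweenSections u V K)
    {σ : Finset Space} (hσ : σ ∈ K.faces) : σ ⊆ V := fun v hv =>
  hK.vertices_subset
    (K.down_closed hσ (Finset.singleton_subset_iff.2 hv) (Finset.singleton_nonempty v))

theorem IsTriangulationBetweenSections.finite_faces (hK : IsTriangulationBetweenSections u V K) :
    K.faces.Finite :=
  (V.powerset.finite_toSet).subset fun _ hσ => Finset.mem_coe.2
    (Finset.mem_powerset.2 (hK.face_subset hσ))

theorem isTetrahedron_of_mem {t : Finset Space} (ht : t ∈ tetrahedra K) : IsTetrahedron t :=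
  ⟨K.indep ht.1, ht.2⟩

theorem card_le_four {σ : Finset Space} (hσ : σ ∈ K.faces) : σ.card ≤ 4 := by
  have h1 := (K.indep hσ).card_le_finrank_succ
  have h2 := Submodule.finrank_le (vectorSpan ℝ (Set.range ((↑) : σ → Space)))
  simp only [Fintype.card_coe, finrank_euclideanSpace, Fintype.card_fin] at h1 h2
  omega

theorem tetrahedron_subset_space {t : Finset Space} (ht : t ∈ tetrahedra K) :
    convexHull ℝ (t : Set Space) ⊆ K.space :=
  SimplicialComplex.convexHull_subset_space ht.1

theorem isClosed_convexHull_finset (σ : Finset Space) : IsClosed (convexHull ℝ (σ : Set Space)) :=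
  (σ.finite_toSet.isCompact_convexHull (𝕜 := ℝ)).isClosed

theorem IsTriangulationBetweenSections.isCompact_space
    (hK : IsTriangulationBetweenSections u V K) : IsCompact K.space :=
  hK.finite_faces.isCompact_biUnion fun σ _ => σ.finite_toSet.isCompact_convexHull (𝕜 := ℝ)

theorem eq_of_mem_interior {s t : Finset Space} (hs : s ∈ tetrahedra K) (ht : t ∈ tetrahedra K)
    {x : Space} (hx : x ∈ interior (convexHull ℝ (s : Set Space)))
    (hx' : x ∈ convexHull ℝ (t : Set Space)) : s = t :=
  Finset.eq_of_subset_of_card_le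
    (subset_of_mem_openHull hs.1 ht.1 ((isTetrahedron_of_mem hs).mem_openHull_self hx) hx')
    (ht.2.trans hs.2.symm).le

variable (hV : GeneralPosition u V) (he : IsVertical u e)
  (hK : IsTriangulationBetweenSections u V K)
include hV he hK

omit hV in
theorem sub_smul_mem_space {x : Space} (hx : x ∈ K.space) {c d : ℝ}
    (hxc : x - c • e ∈ K.space) (h0 : 0 ≤ d) (hd : d ≤ c) : x - d • e ∈ K.space := by
  rcases eq_or_lt_of_le (h0.trans hd) with h | hc
  · obtain rfl : d = 0 := by linarith
    simpa using hx
  refine hK.segment_subset x hx _ hxc ?_ ⟨1 - d / c, d / c, ?_, by positivity, by ring, ?_⟩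
  · rw [sub_eq_add_neg, ← neg_smul, he.proj_add_smul]
  · rw [sub_nonneg, div_le_one hc]
    exact hd
  · have : d / c * c = d := by field_simp
    rw [smul_sub, smul_smul, this]
    module

/-- Among finitely many faces, one contains `x - d • e` for arbitrarily small `d > 0`. It is closed,
so it contains `x`; holding two points of a vertical line, it has four vertices. -/
theorem exists_tetrahedron_below {x : Space} (hx : x ∈ K.space) {c : ℝ} (hc : 0 < c)
    (hxc : x - c • e ∈ K.space) :
    ∃ t ∈ tetrahedra K, x ∈ convexHull ℝ (t : Set Space) ∧
      ∃ c' : ℝ, 0 < c' ∧ x - c' • e ∈ convexHull ℝ (t : Set Space) := by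
  have h1 : ∀ᶠ d in nhdsWithin (0 : ℝ) (Set.Ioi 0), x - d • e ∈ K.space := by
    filter_upwards [Ioc_mem_nhdsGT hc] with d hd
    exact sub_smul_mem_space he hK hx hxc hd.1.le hd.2
  obtain ⟨s, hs, hfr⟩ : ∃ s ∈ K.faces, ∃ᶠ d in nhdsWithin (0 : ℝ) (Set.Ioi 0),
      x - d • e ∈ convexHull ℝ (s : Set Space) := by
    by_contra! h
    obtain ⟨d, hd, hd'⟩ := (h1.and ((Filter.eventually_all_finite hK.finite_faces).2 h)).exists
    obtain ⟨s, hs, hds⟩ := SimplicialComplex.mem_space_iff.1 hd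
    exact hd' s hs hds
  have hxs : x ∈ convexHull ℝ (s : Set Space) := by
    refine (isClosed_convexHull_finset s).mem_of_frequently_of_tendsto hfr ?_
    have : Filter.Tendsto (fun d : ℝ => x - d • e) (nhdsWithin 0 (Set.Ioi 0))
        (nhds (x - (0 : ℝ) • e)) :=
      tendsto_nhdsWithin_of_tendsto_nhds (Continuous.tendsto (by fun_prop) 0)
    simpa using this
  obtain ⟨d, hd, hd0⟩ := (hfr.and_eventually self_mem_nhdsWithin).exists
  refine ⟨s, ⟨hs, ?_⟩, hxs, d, hd0, hd⟩
  by_contra hcard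
  have h3 : s.card ≤ 3 := by
    have := card_le_four hs
    omega
  have := hV.injOn_convexHull (hK.face_subset hs) h3 hxs hd (by
    rw [sub_eq_add_neg, ← neg_smul, he.proj_add_smul])
  rw [eq_comm, sub_eq_self, smul_eq_zero] at this
  exact this.elim (ne_of_gt hd0) he.ne_zero

theorem exists_sub_mem_interior_of_rising {t : Finset Space} (ht : t ∈ tetrahedra K)
    {σ : Finset Space} (hσ : σ ⊆ t) (hr : rising e t ⊆ σ) {x : Space} (hx : x ∈ openHull σ) :
    ∃ c : ℝ, 0 < c ∧ x - c • e ∈ interior (convexHull ℝ (t : Set Space)) :=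
  (isTetrahedron_of_mem ht).exists_sub_mem_interior
    (hV.slope_ne_zero he (isTetrahedron_of_mem ht) (hK.face_subset ht.1)) hσ hr hx

/-- Points in the relative interior of `σ` can be moved downwards as soon as some point of `σ`
can. -/
theorem exists_rising_subset_subset {t σ : Finset Space} (ht : t ∈ tetrahedra K)
    (hσ : σ ∈ K.faces) (hr : rising e t ⊆ σ) :
    ∃ t' ∈ tetrahedra K, rising e t' ⊆ σ ∧ σ ⊆ t' := by
  obtain ⟨y, hy⟩ := openHull_nonempty ((isTetrahedron_of_mem ht).rising_nonempty he.ne_zero)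
  obtain ⟨c, hc, hyc⟩ := exists_sub_mem_interior_of_rising hV he hK ht (rising_subset e t)
    subset_rfl hy
  have hyσ := convexHull_mono (Finset.coe_subset.2 hr) (openHull_subset _ hy)
  rw [sub_eq_add_neg] at hyc
  -- The point `y` may lie on the boundary of `σ`. After the perturbation, any tetrahedron through
  -- the point contains all of `σ`.
  obtain ⟨y', hy', hyc'⟩ := exists_mem_openHull_perturb
    (SimplicialComplex.nonempty_of_mem_faces hσ) hyσ isOpen_interior hyc
  rw [← sub_eq_add_neg] at hyc'
  obtain ⟨t', ht', hyt', c', hc', hyc''⟩ := exists_tetrahedron_below hV he hK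
    (SimplicialComplex.convexHull_subset_space hσ (openHull_subset _ hy')) hc
    (tetrahedron_subset_space ht (interior_subset hyc'))
  have hsub := subset_of_mem_openHull hσ ht'.1 hy' hyt'
  exact ⟨t', ht', (isTetrahedron_of_mem ht').rising_subset_of_sub_mem hsub
    (openHull_subset _ hy') hc' hyc'', hsub⟩

/-- If `rising e t ⊆ σ`, relative interior points of the rising set have points of `t` below them.
Conversely, if `x` in `σ` has a point of `K` below it, some tetrahedron contains `x` and a point
below it, and its rising set lies in the carrier of `x`. -/
theorem lower_iff {σ : Finset Space} (hσ : σ ∈ K.faces) :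
    Lower e K.space σ ↔ ∀ t ∈ tetrahedra K, ¬ rising e t ⊆ σ := by
  constructor
  · intro h t ht hr
    obtain ⟨y, hy⟩ := openHull_nonempty ((isTetrahedron_of_mem ht).rising_nonempty he.ne_zero)
    obtain ⟨c, hc, hyc⟩ := exists_sub_mem_interior_of_rising hV he hK ht (rising_subset e t)
      subset_rfl hy
    have := h y (convexHull_mono (Finset.coe_subset.2 hr) (openHull_subset _ hy)) (-c) (by
      rw [neg_smul, ← sub_eq_add_neg]
      exact tetrahedron_subset_space ht (interior_subset hyc))
    linarith
  · intro h x hx c hc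
    by_contra! hneg
    obtain ⟨t, ht, hxt, c', hc', hxc⟩ := exists_tetrahedron_below (c := -c) hV he hK
      (SimplicialComplex.convexHull_subset_space hσ hx) (neg_pos.2 hneg)
      (by rwa [neg_smul, sub_neg_eq_add])
    obtain ⟨τ, hτ, hne, hxτ⟩ := exists_mem_openHull hx
    have hτt := subset_of_mem_openHull (K.down_closed hσ hτ hne) ht.1 hxτ hxt
    exact h t ht (((isTetrahedron_of_mem ht).rising_subset_of_sub_mem hτt
      (openHull_subset _ hxτ) hc' hxc).trans hτ)

/-- One relative interior point decides for the whole face: if some point of `σ` can descend in `K`,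
then a single tetrahedron containing `σ` lets all relative interior points descend. -/
theorem lower_of_mem_openHull {σ : Finset Space} (hσ : σ ∈ K.faces) {x : Space}
    (hx : x ∈ openHull σ) (h : ∀ c : ℝ, x + c • e ∈ K.space → 0 ≤ c) : Lower e K.space σ := by
  rw [lower_iff hV he hK hσ]
  intro t ht hr
  obtain ⟨t', ht', hr', hσ'⟩ := exists_rising_subset_subset hV he hK ht hσ hr
  obtain ⟨c, hc, hxc⟩ := exists_sub_mem_interior_of_rising hV he hK ht' hσ' hr' hx
  have := h (-c) (by
    rw [neg_smul, ← sub_eq_add_neg]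
    exact tetrahedron_subset_space ht' (interior_subset hxc))
  linarith

omit hV in
theorem exists_lowest {p : Plane u} (hp : p ∈ convexHull ℝ (shadow u V)) :
    ∃ x ∈ K.space, proj u x = p ∧ ∀ c : ℝ, x + c • e ∈ K.space → 0 ≤ c := by
  rw [← hK.proj_space] at hp
  obtain ⟨y, hy, hyp⟩ := hp
  have hcomp : IsCompact (K.space ∩ proj u ⁻¹' {p}) :=
    hK.isCompact_space.inter_right (isClosed_singleton.preimage (proj u).continuous)
  obtain ⟨x, ⟨hx, hxp⟩, hmin⟩ := hcomp.exists_isMinOn ⟨y, hy, hyp⟩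
    (f := fun x => inner ℝ e x) (by fun_prop)
  refine ⟨x, hx, hxp, fun c hc => ?_⟩
  have h := hmin ⟨hc, (he.proj_add_smul x c).trans hxp⟩
  simp only [Set.mem_ofPred_eq, inner_add_right, inner_smul_right, real_inner_self_eq_norm_sq] at h
  have hn : 0 < ‖e‖ ^ 2 := by
    have := norm_pos_iff.2 he.ne_zero
    positivity
  nlinarith

theorem card_le_three_of_lower {σ : Finset Space} (hσ : σ ∈ K.faces) (h : Lower e K.space σ) :
    σ.card ≤ 3 := by
  by_contra hc
  have h4 : σ.card = 4 := by
    have := card_le_four hσ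
    omega
  exact (lower_iff hV he hK hσ).1 h σ ⟨hσ, h4⟩ (rising_subset e σ)

end Complex

/-- The projections of the lower faces of `K`, when `e` points upwards. -/
def lowerTri (u e : Space) (K : SimplicialComplex ℝ Space) : Set (Finset (Plane u)) :=
  projFace u '' {σ | σ ∈ K.faces ∧ Lower e K.space σ}

/-- Points of two lower faces with the same projection coincide, neither being below the other, so
intersections are inherited from `K`. The plane region is covered because the carrier of a lowest
point is a lower face. -/
theorem isTriangulation_lowerTri {u e : Space} {V : Finset Space} {K : SimplicialComplex ℝ Space}
    (hV : GeneralPosition u V) (he : IsVertical u e)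
    (hK : IsTriangulationBetweenSections u V K) :
    IsTriangulation (shadow u V) (lowerTri u e K) := by
  classical
  refine ⟨{ faces := lowerTri u e K, isRelLowerSet_faces := ?_, indep := ?_,
            inter_subset_convexHull := ?_ }, rfl, ?_, ?_⟩
  · rintro _ ⟨σ, ⟨hσ, hl⟩, rfl⟩
    refine ⟨(SimplicialComplex.nonempty_of_mem_faces hσ).image _, fun ρ hρ hne => ?_⟩
    obtain ⟨τ, hτ, rfl⟩ := Finset.subset_image_iff.1 hρ
    exact ⟨τ, ⟨K.down_closed hσ hτ (Finset.image_nonempty.1 hne), hl.mono hτ⟩, rfl⟩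
  · rintro _ ⟨σ, ⟨hσ, hl⟩, rfl⟩
    exact hV.affineIndependent_projFace (hK.face_subset hσ)
      (card_le_three_of_lower hV he hK hσ hl)
  · rintro _ _ ⟨σ, ⟨hσ, hl⟩, rfl⟩ ⟨τ, ⟨hτ, hl'⟩, rfl⟩ p ⟨hp, hp'⟩
    rw [convexHull_projFace] at hp hp'
    obtain ⟨x, hx, rfl⟩ := hp
    obtain ⟨y, hy, hxy⟩ := hp'
    obtain ⟨c, rfl⟩ := he.exists_eq_add_smul hxy
    have h1 := hl x hx c (SimplicialComplex.convexHull_subset_space hτ hy)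
    have h2 := hl' _ hy (-c) (by
      rw [neg_smul, add_neg_cancel_right]
      exact SimplicialComplex.convexHull_subset_space hσ hx)
    obtain rfl : c = 0 := by linarith
    rw [zero_smul, add_zero] at hy
    have h3 := K.inter_subset_convexHull hσ hτ ⟨hx, hy⟩
    rw [← Finset.coe_inter] at h3
    have h4 : proj u x ∈ convexHull ℝ (projFace u (σ ∩ τ) : Set (Plane u)) := by
      rw [convexHull_projFace]
      exact ⟨x, h3, rfl⟩
    refine convexHull_mono ?_ h4
    rw [← Finset.coe_inter]
    exact Finset.coe_subset.2 (Finset.image_inter_subset _ _ _)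
  · intro p hp
    obtain ⟨σ, ⟨hσ, -⟩, h⟩ := hp
    obtain ⟨v, hv, rfl⟩ := mem_projFace.1 (h ▸ Finset.mem_singleton_self p)
    exact ⟨v, hK.face_subset hσ hv, rfl⟩
  · ext p
    rw [SimplicialComplex.mem_space_iff]
    constructor
    · rintro ⟨_, ⟨σ, ⟨hσ, -⟩, rfl⟩, hp⟩
      rw [convexHull_projFace] at hp
      rw [← hK.proj_space]
      exact Set.image_mono (SimplicialComplex.convexHull_subset_space hσ) hp
    · intro hp
      obtain ⟨x, hx, rfl, hmin⟩ := exists_lowest he hK hp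
      obtain ⟨σ, hσ, hxσ⟩ := exists_face_openHull hx
      refine ⟨_, ⟨σ, ⟨hσ, lower_of_mem_openHull hV he hK hσ hxσ hmin⟩, rfl⟩, ?_⟩
      rw [convexHull_projFace]
      exact ⟨x, openHull_subset _ hxσ, rfl⟩

/-! ### Radon partitions and removable tetrahedra -/

section Radon

variable {u e : Space} {V t : Finset Space}

/-- Separate positive and negative terms in `∑ slope e t v • v = e` and divide by the sum `S` of the
positive slopes. The two convex combinations differ by `S⁻¹ • e`, so they project to one Radon
point. -/
theorem IsTetrahedron.exists_radon (ht : IsTetrahedron t) (he : e ≠ 0) :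
    ∃ x ∈ openHull (rising (-e) t), ∃ y ∈ openHull (rising e t), ∃ c : ℝ, y = x + c • e := by
  classical
  set S := ∑ v ∈ rising e t, slope e t v with hS
  have hpos : 0 < S := Finset.sum_pos (fun v hv => (mem_rising.1 hv).2) (ht.rising_nonempty he)
  have hdisj : Disjoint (rising (-e) t) (rising e t) := by
    rw [Finset.disjoint_left]
    intro v hv hv'
    have h1 := (mem_rising.1 hv).2
    have h2 := (mem_rising.1 hv').2
    rw [slope_neg] at h1
    linarith
  have hz : ∀ v ∈ t, v ∉ rising (-e) t ∪ rising e t → slope e t v = 0 := by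
    intro v hv hv'
    simp only [Finset.mem_union, mem_rising, slope_neg, hv, true_and, not_or, not_lt] at hv'
    linarith [hv'.1, hv'.2]
  have hsub : rising (-e) t ∪ rising e t ⊆ t :=
    Finset.union_subset (rising_subset _ t) (rising_subset _ t)
  have h0 := ht.sum_slope e
  rw [← Finset.sum_subset hsub hz, Finset.sum_union hdisj, ← hS] at h0
  have h1 := ht.sum_slope_smul e
  rw [← Finset.sum_subset hsub fun v hv hv' => by rw [hz v hv hv', zero_smul],
    Finset.sum_union hdisj] at h1
  refine ⟨_, ⟨fun v => S⁻¹ * slope (-e) t v, fun v hv => ?_, ?_, rfl⟩,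
    _, ⟨fun v => S⁻¹ * slope e t v, fun v hv => ?_, ?_, rfl⟩, S⁻¹, ?_⟩
  · exact mul_pos (inv_pos.2 hpos) (mem_rising.1 hv).2
  · simp only [slope_neg, ← Finset.mul_sum, Finset.sum_neg_distrib]
    rw [eq_neg_of_add_eq_zero_left h0, neg_neg, inv_mul_cancel₀ hpos.ne']
  · exact mul_pos (inv_pos.2 hpos) (mem_rising.1 hv).2
  · rw [← Finset.mul_sum, ← hS, inv_mul_cancel₀ hpos.ne']
  · nth_rewrite 5 [← h1]
    simp only [slope_neg, mul_smul, neg_smul, ← Finset.smul_sum, Finset.sum_neg_distrib]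
    module

theorem openHull_singleton {x v : Space} (hx : x ∈ openHull {v}) : x = v := by
  simpa using openHull_subset _ hx

theorem GeneralPosition.rising_neg_eq (hV : GeneralPosition u V) (he : IsVertical u e)
    (ht : IsTetrahedron t) (htV : t ⊆ V) [DecidableEq Space] :
    rising (-e) t = t \ rising e t := by
  ext v
  rw [Finset.mem_sdiff]
  refine ⟨fun h => ⟨rising_subset _ _ h,
    (hV.mem_rising_neg_iff he ht htV (rising_subset _ _ h)).1 h⟩, fun h => ?_⟩
  exact (hV.mem_rising_neg_iff he ht htV h.1).2 h.2

open scoped Classical in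
-- Write `v = y + c • e` with `y` in the opposite facet. From `y` to `v` the coordinate of `v` grows
-- from zero, and every other one falls to zero or stays there. So `v` is alone in its class, and
-- the sign of `c` tells which class it is.
theorem IsTetrahedron.rising_eq_singleton (ht : IsTetrahedron t) (he : IsVertical u e) {v : Space} (hv : v ∈ t)
    (h : proj u v ∈ convexHull ℝ (projFace u (t.erase v) : Set (Plane u))) :
    rising e t = {v} ∨ rising (-e) t = {v} := by
  rw [convexHull_projFace] at h
  obtain ⟨y, hy, hyv⟩ := h
  obtain ⟨c, hc⟩ := he.exists_eq_add_smul hyv.symm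
  have h0 : coord t v y = 0 :=
    ht.coord_eq_zero (Finset.erase_subset v t) hy hv (Finset.notMem_erase v t)
  have hself : v ∈ openHull {v} := ⟨fun _ => 1, by simp⟩
  have hself' : v ∈ convexHull ℝ (({v} : Finset Space) : Set Space) := openHull_subset _ hself
  have h1 : 0 < coord t v v :=
    ht.coord_pos (Finset.singleton_subset_iff.2 hv) hself (Finset.mem_singleton_self v)
  have h2 : 0 < c * slope e t v := by
    have := coord_add_smul t v y e c
    rw [← hc, h0, zero_add] at this
    rwa [← this]
  have h3 : ∀ w ∈ t, w ≠ v → c * slope e t w ≤ 0 := by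
    intro w hw hwv
    have h4 := coord_add_smul t w y e c
    rw [← hc, ht.coord_eq_zero (Finset.singleton_subset_iff.2 hv) hself' hw (by simpa using hwv)]
      at h4
    have := ht.mem_convexHull_iff.1
      (convexHull_mono (Finset.coe_subset.2 (Finset.erase_subset v t)) hy) w hw
    linarith
  rcases lt_or_ge 0 c with hpos | hneg
  · left
    ext w
    rw [mem_rising, Finset.mem_singleton]
    constructor
    · rintro ⟨hw, hs⟩
      by_contra hwv
      nlinarith [h3 w hw hwv]
    · rintro rfl
      exact ⟨hv, pos_of_mul_pos_right h2 hpos.le⟩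
  · right
    ext w
    rw [mem_rising, slope_neg, Finset.mem_singleton]
    have hneg : c < 0 := lt_of_le_of_ne hneg (by rintro rfl; simp at h2)
    constructor
    · rintro ⟨hw, hs⟩
      by_contra hwv
      nlinarith [h3 w hw hwv]
    · rintro rfl
      exact ⟨hv, by nlinarith⟩

theorem finrank_plane (hu : u ≠ 0) : Module.finrank ℝ (Plane u) = 2 := by
  have : Fact (Module.finrank ℝ Space = 2 + 1) := ⟨by simp⟩
  exact Submodule.finrank_orthogonal_span_singleton hu

theorem GeneralPosition.proj_mem_interior (hu : u ≠ 0) (hV : GeneralPosition u V)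
    {σ : Finset Space} (hσ : σ ⊆ V) (hc : σ.card = 3) {x : Space} (hx : x ∈ openHull σ) :
    proj u x ∈ interior (convexHull ℝ (projFace u σ : Set (Plane u))) := by
  have hind := hV.affineIndependent_proj hσ hc.le
  let b : AffineBasis σ ℝ (Plane u) := ⟨_, hind, by
    rw [hind.affineSpan_eq_top_iff_card_eq_finrank_add_one, finrank_plane hu]
    simp [hc]⟩
  have hb : Set.range b = (projFace u σ : Set (Plane u)) := by
    rw [coe_projFace]
    ext p
    exact ⟨fun ⟨v, hv⟩ => ⟨v, v.2, hv⟩, fun ⟨v, hv, h⟩ => ⟨⟨v, hv⟩, h⟩⟩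
  rw [← hb, b.interior_convexHull]
  intro v
  obtain ⟨w, h0, h1, rfl⟩ := hx
  have h1' : ∑ v : σ, w v = 1 := by rw [Finset.sum_coe_sort σ w, h1]
  have := b.coord_apply_combination_of_mem (Finset.mem_univ v) (w := fun v => w v) h1'
  rw [Finset.affineCombination_eq_linear_combination _ _ _ h1'] at this
  rw [map_sum, ← Finset.sum_coe_sort σ]
  simp only [map_smul]
  exact this.symm ▸ h0 v v.2

end Radon

/-- The lower facets of the tetrahedron `t` lie on the lower side of `K`. -/
def Exposed (e : Space) (K : SimplicialComplex ℝ Space) (t : Finset Space) : Prop :=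
  open scoped Classical in ∀ v ∈ rising e t, Lower e K.space (t.erase v)

section Removable

variable {u e : Space} {V t : Finset Space} {K : SimplicialComplex ℝ Space}

theorem Exposed.lower (h : Exposed e K t) {σ : Finset Space} (hσ : σ ⊆ t)
    (hr : ¬ rising e t ⊆ σ) : Lower e K.space σ := by
  classical
  obtain ⟨v, hv, hvσ⟩ := Finset.not_subset.1 hr
  refine (h v hv).mono fun w hw => Finset.mem_erase.2 ⟨?_, hσ hw⟩
  rintro rfl
  exact hvσ hw

theorem projFace_eq_projFace (hV : GeneralPosition u V) {σ τ : Finset Space} (hσ : σ ⊆ V)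
    (hτ : τ ⊆ V) : projFace u σ = projFace u τ ↔ σ = τ := by
  refine ⟨fun h => ?_, fun h => h ▸ rfl⟩
  exact ((hV.projFace_subset_iff hσ hτ).1 h.le).antisymm ((hV.projFace_subset_iff hτ hσ).1 h.ge)

variable (hV : GeneralPosition u V) (he : IsVertical u e)
  (hK : IsTriangulationBetweenSections u V K)
include hV hK

theorem projFace_mem_lowerTri {σ : Finset Space} (hσ : σ ⊆ V) :
    projFace u σ ∈ lowerTri u e K ↔ σ ∈ K.faces ∧ Lower e K.space σ := by
  constructor
  · rintro ⟨τ, ⟨hτ, hl⟩, h⟩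
    obtain rfl := (projFace_eq_projFace hV (hK.face_subset hτ) hσ).1 h
    exact ⟨hτ, hl⟩
  · exact fun h => ⟨σ, h, rfl⟩


/-- The facet opposite a vertex that is not rising contains the whole rising set, hence is not
lower. -/
theorem mem_rising_of_lower [DecidableEq Space] (he : IsVertical u e) (ht : t ∈ tetrahedra K)
    {v : Space} (h : projFace u (t.erase v) ∈ lowerTri u e K) : v ∈ rising e t := by
  obtain ⟨hf, hl⟩ := (projFace_mem_lowerTri hV hK
    ((Finset.erase_subset v t).trans (hK.face_subset ht.1))).1 h
  by_contra hv
  exact (lower_iff hV he hK hf).1 hl t ht (Finset.subset_erase.2 ⟨rising_subset e t, hv⟩)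

end Removable

/-! ### The three planar flip types and the Radon partition -/

section Planar

variable {u e : Space} {V t : Finset Space} {K : SimplicialComplex ℝ Space}

open scoped Classical in
@[simp] theorem projFace_insert (u a : Space) (σ : Finset Space) :
    projFace u (insert a σ) = insert (proj u a) (projFace u σ) :=
  Finset.image_insert _ _ _

@[simp] theorem projFace_singleton (u a : Space) : projFace u {a} = {proj u a} :=
  Finset.image_singleton _ _

theorem ne_of_card_eq_four {α : Type*} [DecidableEq α] {a b c d : α}
    (h : ({a, b, c, d} : Finset α).card = 4) :
    a ≠ b ∧ a ≠ c ∧ a ≠ d ∧ b ≠ c ∧ b ≠ d ∧ c ≠ d := by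
  have h2 := Finset.card_le_two (a := c) (b := d)
  grind

theorem erase_quad {α : Type*} [DecidableEq α] {a b c d : α}
    (h : ({a, b, c, d} : Finset α).card = 4) :
    ({a, b, c, d} : Finset α).erase a = {b, c, d} ∧ ({a, b, c, d} : Finset α).erase b = {c, a, d} ∧
    ({a, b, c, d} : Finset α).erase c = {a, b, d} ∧ ({a, b, c, d} : Finset α).erase d = {a, b, c} := by
  obtain ⟨hab, hac, had, hbc, hbd, hcd⟩ := ne_of_card_eq_four h
  refine ⟨?_, ?_, ?_, ?_⟩ <;> ext x <;> simp only [Finset.mem_erase, Finset.mem_insert,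
    Finset.mem_singleton] <;> grind

theorem quad_sdiff_eq_pair {α : Type*} [DecidableEq α] {a b c d : α} {R : Finset α}
    (h : ({a, b, c, d} : Finset α).card = 4) (hR : R ⊆ {a, b, c, d}) (hc : c ∈ R) (hd : d ∈ R)
    (hne : (({a, b, c, d} : Finset α) \ R).Nonempty) (ha' : ({a, b, c, d} : Finset α) \ R ≠ {a})
    (hb' : ({a, b, c, d} : Finset α) \ R ≠ {b}) :
    ({a, b, c, d} : Finset α) \ R = {a, b} ∧ R = {c, d} := by
  obtain ⟨hab, hac, had, hbc, hbd, hcd⟩ := ne_of_card_eq_four h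
  have ha : a ∉ R := fun ha => by
    refine hb' (hne.subset_singleton_iff.1 fun x hx => ?_)
    simp only [Finset.mem_sdiff, Finset.mem_insert, Finset.mem_singleton] at hx ⊢
    rcases hx.1 with rfl | rfl | rfl | rfl <;> first | rfl | exact absurd ‹_› hx.2
  have hb : b ∉ R := fun hb => by
    refine ha' (hne.subset_singleton_iff.1 fun x hx => ?_)
    simp only [Finset.mem_sdiff, Finset.mem_insert, Finset.mem_singleton] at hx ⊢
    rcases hx.1 with rfl | rfl | rfl | rfl <;> first | rfl | exact absurd ‹_› hx.2
  have hR' : R = {c, d} := by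
    ext x
    simp only [Finset.mem_insert, Finset.mem_singleton]
    constructor
    · intro hx
      have := hR hx
      simp only [Finset.mem_insert, Finset.mem_singleton] at this
      rcases this with rfl | rfl | h | h
      · exact absurd hx ha
      · exact absurd hx hb
      · exact Or.inl h
      · exact Or.inr h
    · rintro (rfl | rfl) <;> assumption
  refine ⟨?_, hR'⟩
  rw [hR']
  ext x
  simp only [Finset.mem_sdiff, Finset.mem_insert, Finset.mem_singleton]
  grind

theorem quad_sdiff_eq_singleton {α : Type*} [DecidableEq α] {a b c d : α} {R : Finset α}
    (h : ({a, b, c, d} : Finset α).card = 4) (hR : R ⊆ {a, b, c, d}) (ha : a ∈ R) (hb : b ∈ R)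
    (hc : c ∈ R) (hne : (({a, b, c, d} : Finset α) \ R).Nonempty) :
    ({a, b, c, d} : Finset α) \ R = {d} ∧ R = {a, b, c} := by
  have hd : ({a, b, c, d} : Finset α) \ R = {d} := by
    refine hne.subset_singleton_iff.1 fun x hx => ?_
    simp only [Finset.mem_sdiff, Finset.mem_insert, Finset.mem_singleton] at hx ⊢
    rcases hx.1 with rfl | rfl | rfl | rfl <;> first | rfl | exact absurd ‹_› hx.2
  refine ⟨hd, ?_⟩
  rw [← Finset.sdiff_sdiff_eq_self hR, hd, Finset.sdiff_singleton_eq_erase]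
  exact (erase_quad h).2.2.2

theorem coe_projFace_sdiff [DecidableEq Space] (hV : GeneralPosition u V) (htV : t ⊆ V) {v : Space}
    (hv : v ∈ t) :
    (projFace u t : Set (Plane u)) \ {proj u v} = (projFace u (t.erase v) : Set (Plane u)) := by
  ext p
  simp only [Set.mem_sdiff, Set.mem_singleton_iff, Finset.mem_coe, mem_projFace, Finset.mem_erase]
  constructor
  · rintro ⟨⟨w, hw, rfl⟩, h⟩
    exact ⟨w, ⟨fun h' => h (h' ▸ rfl), hw⟩, rfl⟩
  · rintro ⟨w, ⟨hne, hw⟩, rfl⟩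
    exact ⟨⟨w, hw, rfl⟩, fun h => hne (hV.1 (htV hw) (htV hv) h)⟩

/-- If `v` were the only rising vertex, the Radon point would be `proj u v`, in the hull of the
other three projections. -/
theorem rising_ne_singleton (hV : GeneralPosition u V) (he : IsVertical u e)
    (ht : IsTetrahedron t) (htV : t ⊆ V)
    (h : ConvexIndependent ℝ ((↑) : ↥(projFace u t : Set (Plane u)) → Plane u)) (v : Space) :
    rising e t ≠ {v} := by
  classical
  intro hr
  have hv : v ∈ t := rising_subset e t (hr ▸ Finset.mem_singleton_self v)
  rw [convexIndependent_set_iff_notMem_convexHull_sdiff] at h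
  apply h (proj u v) (mem_projFace.2 ⟨v, hv, rfl⟩)
  rw [coe_projFace_sdiff hV htV hv, convexHull_projFace]
  obtain ⟨x, hx, y, hy, c, hc⟩ := ht.exists_radon he.ne_zero
  rw [hr] at hy
  rw [openHull_singleton hy] at hc
  refine ⟨x, convexHull_mono (Finset.coe_subset.2 ?_) (openHull_subset _ hx), ?_⟩
  · rw [hV.rising_neg_eq he ht htV, hr, Finset.sdiff_singleton_eq_erase]
  · rw [hc, he.proj_add_smul]

open scoped Classical in
theorem exists_lift_quad (hV : GeneralPosition u V) (htV : t ⊆ V) {p q r s : Plane u}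
    (h : {p, q, r, s} = projFace u t) : ∃ a b c d : Space, t = {a, b, c, d} ∧
      proj u a = p ∧ proj u b = q ∧ proj u c = r ∧ proj u d = s := by
  have hp : p ∈ projFace u t := h ▸ by simp
  have hq : q ∈ projFace u t := h ▸ by simp
  have hr : r ∈ projFace u t := h ▸ by simp
  have hs : s ∈ projFace u t := h ▸ by simp
  obtain ⟨a, ha, rfl⟩ := mem_projFace.1 hp
  obtain ⟨b, hb, rfl⟩ := mem_projFace.1 hq
  obtain ⟨c, hc, rfl⟩ := mem_projFace.1 hr
  obtain ⟨d, hd, rfl⟩ := mem_projFace.1 hs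
  refine ⟨a, b, c, d, ?_, rfl, rfl, rfl, rfl⟩
  have hsub : ({a, b, c, d} : Finset Space) ⊆ V := by
    refine Finset.Subset.trans ?_ htV
    simp [Finset.insert_subset_iff, *]
  rw [← projFace_eq_projFace hV htV hsub, ← h]
  simp

variable (hV : GeneralPosition u V) (he : IsVertical u e)
  (hK : IsTriangulationBetweenSections u V K)
include hV he hK

/-- A removable tetrahedron has all its lower facets on the lower side of `K`, and the flip
replaces its lower faces by its upper ones. -/
theorem RemovableBy.exposed (ht : t ∈ tetrahedra K) {U W : Finset (Plane u)}
    (h : RemovableBy (lowerTri u e K) t U W) :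
    Exposed e K t ∧ U = projFace u (rising (-e) t) ∧ W = projFace u (rising e t) := by
  classical
  obtain ⟨hUW, hf⟩ := h
  have htV := hK.face_subset ht.1
  have htt := isTetrahedron_of_mem ht
  have hlow : ∀ v, projFace u (t.erase v) ∈ lowerTri u e K → Lower e K.space (t.erase v) :=
    fun v hv => ((projFace_mem_lowerTri hV hK ((Finset.erase_subset v t).trans htV)).1 hv).2
  have hmem : ∀ v, projFace u (t.erase v) ∈ lowerTri u e K → v ∈ rising e t :=
    fun v hv => mem_rising_of_lower hV hK he ht hv
  have hU := hV.rising_neg_eq he htt htV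
  have hUne := htt.rising_nonempty he.neg.ne_zero
  cases hf with
  | insertion p q r s h1 h2 =>
    obtain ⟨a, b, c, d, hteq, rfl, rfl, rfl, rfl⟩ := exists_lift_quad hV htV
      (show {p, q, r, s} = projFace u t by rw [← hUW]; ext; simp)
    have hcard : ({a, b, c, d} : Finset Space).card = 4 := hteq ▸ ht.2
    obtain ⟨ha, hb, hc, hd⟩ := erase_quad hcard
    rw [← hteq] at ha hb hc hd
    have e1 : ({proj u a, proj u b, proj u c} : Finset (Plane u)) = projFace u (t.erase d) := by
      simp [hd]
    rw [e1] at h1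
    have hdW := hmem d h1
    -- Since `d` projects into the triangle, it is alone in its class; it is rising because the
    -- opposite facet is lower.
    have hW : rising e t = {d} := by
      refine (htt.rising_eq_singleton he (v := d) (rising_subset _ _ hdW) ?_).resolve_right ?_
      · rw [← e1]
        simpa using interior_subset h2
      · intro h
        have : d ∈ rising (-e) t := h ▸ Finset.mem_singleton_self d
        rw [hU] at this
        exact (Finset.mem_sdiff.1 this).2 hdW
    refine ⟨fun v hv => ?_, ?_, ?_⟩
    · rw [hW, Finset.mem_singleton] at hv
      exact hv ▸ hlow d h1
    · rw [hU, hW, Finset.sdiff_singleton_eq_erase, e1]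
    · rw [hW, projFace_singleton]
  | edge p q r s h1 h2 h3 =>
    obtain ⟨a, b, c, d, hteq, rfl, rfl, rfl, rfl⟩ := exists_lift_quad hV htV
      (show {p, q, r, s} = projFace u t by rw [← hUW]; ext; simp; tauto)
    have hcard : ({a, b, c, d} : Finset Space).card = 4 := hteq ▸ ht.2
    obtain ⟨ha, hb, hc, hd⟩ := erase_quad hcard
    rw [← hteq] at ha hb hc hd
    have e1 : ({proj u a, proj u b, proj u c} : Finset (Plane u)) = projFace u (t.erase d) := by
      simp [hd]
    have e2 : ({proj u a, proj u b, proj u d} : Finset (Plane u)) = projFace u (t.erase c) := by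
      simp [hc]
    rw [e1] at h1
    rw [e2] at h2
    have e3 : ({proj u a, proj u b, proj u c, proj u d} : Set (Plane u)) = projFace u t := by
      simp [hteq]
    rw [e3] at h3
    have hdW := hmem d h1
    have hcW := hmem c h2
    -- The vertices `c`, `d` are rising, so the falling set is a nonempty part of `{a, b}`; convex
    -- position rules out a single vertex.
    have hna := rising_ne_singleton hV he.neg htt htV h3 a
    have hnb := rising_ne_singleton hV he.neg htt htV h3 b
    have hsub := rising_subset e t
    rw [hU] at hUne hna hnb ⊢
    obtain ⟨hU', hW⟩ := quad_sdiff_eq_pair hcard (by rwa [← hteq]) hcW hdW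
      (by rwa [← hteq]) (by rwa [← hteq]) (by rwa [← hteq])
    refine ⟨fun v hv => ?_, ?_, ?_⟩
    · rw [hW, Finset.mem_insert, Finset.mem_singleton] at hv
      rcases hv with rfl | rfl
      · exact hlow _ h2
      · exact hlow _ h1
    · rw [← hteq] at hU'
      rw [hU']
      simp
    · simp [hW]
  | deletion p q r s h1 h2 h3 =>
    obtain ⟨a, b, c, d, hteq, rfl, rfl, rfl, rfl⟩ := exists_lift_quad hV htV
      (show {p, q, r, s} = projFace u t by rw [← hUW]; ext; simp; tauto)
    have hcard : ({a, b, c, d} : Finset Space).card = 4 := hteq ▸ ht.2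
    obtain ⟨ha, hb, hc, hd⟩ := erase_quad hcard
    rw [← hteq] at ha hb hc hd
    have e1 : ({proj u a, proj u b, proj u d} : Finset (Plane u)) = projFace u (t.erase c) := by
      simp [hc]
    have e2 : ({proj u b, proj u c, proj u d} : Finset (Plane u)) = projFace u (t.erase a) := by
      simp [ha]
    have e3 : ({proj u c, proj u a, proj u d} : Finset (Plane u)) = projFace u (t.erase b) := by
      simp [hb]
    rw [e1] at h1
    rw [e2] at h2
    rw [e3] at h3
    -- Three vertices are rising, and the falling set is nonempty, so it is `{d}`.
    have hcW := hmem c h1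
    have haW := hmem a h2
    have hbW := hmem b h3
    have hsub := rising_subset e t
    rw [hU] at hUne ⊢
    obtain ⟨hU', hW⟩ := quad_sdiff_eq_singleton hcard (by rwa [← hteq]) haW hbW
      hcW (by rwa [← hteq])
    refine ⟨fun v hv => ?_, ?_, ?_⟩
    · simp only [hW, Finset.mem_insert, Finset.mem_singleton] at hv
      rcases hv with rfl | rfl | rfl
      · exact hlow _ h2
      · exact hlow _ h3
      · exact hlow _ h1
    · rw [← hteq] at hU'
      rw [hU']
      simp
    · simp [hW]

/-- A tetrahedron whose lower facets lie on the lower side of `K` is removable. -/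
theorem Exposed.removableBy (hu : u ≠ 0) (ht : t ∈ tetrahedra K) (h : Exposed e K t) :
    RemovableBy (lowerTri u e K) t (projFace u (rising (-e) t)) (projFace u (rising e t)) := by
  classical
  have htV := hK.face_subset ht.1
  have htt := isTetrahedron_of_mem ht
  have hU := hV.rising_neg_eq he htt htV
  have hsub := rising_subset e t
  have hunion : rising (-e) t ∪ rising e t = t := by rw [hU, Finset.sdiff_union_of_subset hsub]
  have hdisj : Disjoint (rising (-e) t) (rising e t) := hU ▸ Finset.sdiff_disjoint
  have hUne := htt.rising_nonempty he.neg.ne_zero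
  have hWne := htt.rising_nonempty he.ne_zero
  have hcard : (rising (-e) t).card + (rising e t).card = 4 := by
    rw [← Finset.card_union_of_disjoint hdisj, hunion, ht.2]
  have hmem : ∀ σ ⊆ t, σ.Nonempty → ¬ rising e t ⊆ σ → projFace u σ ∈ lowerTri u e K :=
    fun σ hσ hne hr => ⟨σ, ⟨K.down_closed ht.1 hσ hne, h.lower hσ hr⟩, rfl⟩
  have himage : projFace u (rising (-e) t ∪ rising e t) =
      projFace u (rising (-e) t) ∪ projFace u (rising e t) :=
    Finset.image_union (f := proj u) _ _
  refine ⟨by rw [← himage, hunion], ?_⟩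
  have h1 := hUne.card_pos
  have h2 := hWne.card_pos
  -- One, two or three rising vertices give the 1-3, 2-2 or 3-1 flip.
  obtain hc | hc | hc : (rising e t).card = 1 ∨ (rising e t).card = 2 ∨ (rising e t).card = 3 := by
    omega
  · obtain ⟨d, hW⟩ := Finset.card_eq_one.1 hc
    obtain ⟨a, b, c, hab, hac, hbc, hU'⟩ :=
      Finset.card_eq_three.1 (show (rising (-e) t).card = 3 by omega)
    have hm := hmem _ (rising_subset (-e) t) hUne fun h =>
      hWne.ne_empty (disjoint_self.1 (hdisj.mono_left h))
    -- The Radon point is the projection of `d` itself, and it is interior to the triangle of the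
    -- falling vertices.
    obtain ⟨x, hx, y, hy, k, hk⟩ := htt.exists_radon he.ne_zero
    rw [hW] at hy
    have hint := hV.proj_mem_interior hu ((rising_subset (-e) t).trans htV) (by omega) hx
    rw [← he.proj_add_smul x k, ← hk, openHull_singleton hy, hU'] at hint
    rw [hU'] at hm
    rw [hU', hW]
    simp only [projFace_insert, projFace_singleton] at hm hint ⊢
    exact Flippable.insertion _ _ _ _ hm (by simpa using hint)
  · obtain ⟨c, d, hcd, hW⟩ := Finset.card_eq_two.1 hc
    obtain ⟨a, b, hab, hU'⟩ := Finset.card_eq_two.1 (show (rising (-e) t).card = 2 by omega)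
    rw [hU', hW] at hdisj hunion
    have hteq : t = {a, b, c, d} := by rw [← hunion]; ext; simp; tauto
    obtain ⟨-, hac, had, hbc, hbd, -⟩ := ne_of_card_eq_four (hteq ▸ ht.2)
    have hm1 := hmem {a, b, c} (by rw [hteq]; intro x; simp; tauto) (by simp)
      (Finset.not_subset.2 ⟨d, by simp [hW], by simp [had.symm, hbd.symm, hcd.symm]⟩)
    have hm2 := hmem {a, b, d} (by rw [hteq]; intro x; simp; tauto) (by simp)
      (Finset.not_subset.2 ⟨c, by simp [hW], by simp [hac.symm, hbc.symm, hcd]⟩)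
    have hci : ConvexIndependent ℝ ((↑) : ↥(projFace u t : Set (Plane u)) → Plane u) := by
      rw [convexIndependent_set_iff_notMem_convexHull_sdiff]
      intro p hp hp'
      obtain ⟨v, hv, rfl⟩ := mem_projFace.1 hp
      rw [coe_projFace_sdiff hV htV hv] at hp'
      -- Failure of convex position would make one of the two classes a singleton.
      rcases htt.rising_eq_singleton he hv hp' with h' | h' <;>
      · have := congrArg Finset.card h'
        rw [Finset.card_singleton] at this
        omega
    have e3 : (projFace u t : Set (Plane u)) = {proj u a, proj u b, proj u c, proj u d} := by
      simp [hteq]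
    rw [e3] at hci
    rw [hU', hW]
    simp only [projFace_insert, projFace_singleton] at hm1 hm2 ⊢
    exact Flippable.edge _ _ _ _ hm1 hm2 hci
  · obtain ⟨a, b, c, hab, hac, hbc, hW⟩ := Finset.card_eq_three.1 hc
    obtain ⟨d, hU'⟩ := Finset.card_eq_one.1 (show (rising (-e) t).card = 1 by omega)
    rw [hU', hW] at hdisj hunion
    have hteq : t = {a, b, c, d} := by rw [← hunion]; ext; simp; tauto
    obtain ⟨-, -, had, -, hbd, hcd⟩ := ne_of_card_eq_four (hteq ▸ ht.2)
    have hm1 := hmem {a, b, d} (by rw [hteq]; intro x; simp; tauto) (by simp)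
      (Finset.not_subset.2 ⟨c, by simp [hW], by simp [hac.symm, hbc.symm, hcd]⟩)
    have hm2 := hmem {b, c, d} (by rw [hteq]; intro x; simp; tauto) (by simp)
      (Finset.not_subset.2 ⟨a, by simp [hW], by simp [hab, hac, had]⟩)
    have hm3 := hmem {c, a, d} (by rw [hteq]; intro x; simp; tauto) (by simp)
      (Finset.not_subset.2 ⟨b, by simp [hW], by simp [hab.symm, hbc, hbd]⟩)
    rw [hU', hW]
    simp only [projFace_insert, projFace_singleton] at hm1 hm2 hm3 ⊢
    exact Flippable.deletion _ _ _ _ hm1 hm2 hm3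

end Planar

/-! ### Removing a tetrahedron -/

/-- The simplices of `K` that do not contain `U`. -/
def removeStar (K : SimplicialComplex ℝ Space) (U : Finset Space) : SimplicialComplex ℝ Space where
  faces := {σ | σ ∈ K.faces ∧ ¬ U ⊆ σ}
  isRelLowerSet_faces := fun _ hσ => ⟨SimplicialComplex.nonempty_of_mem_faces hσ.1,
    fun _ hτ hne => ⟨K.down_closed hσ.1 hτ hne, fun h => hσ.2 (h.trans hτ)⟩⟩
  indep hs := K.indep hs.1
  inter_subset_convexHull hs ht := K.inter_subset_convexHull hs.1 ht.1

/-- `T₁` and `T₂` are triangulations, and `T₂` arises from `T₁` by replacing the lower faces of the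
tetrahedron `t` by its upper faces, when `e` points upwards. -/
structure IsFlip (u e : Space) (V : Finset Space) (t : Finset Space)
    (T₁ T₂ : Set (Finset (Plane u))) : Prop where
  left : IsTriangulation (shadow u V) T₁
  right : IsTriangulation (shadow u V) T₂
  subset : t ⊆ V
  isTetrahedron : IsTetrahedron t
  lower : projFace u '' {σ | σ.Nonempty ∧ σ ⊆ t ∧ ¬ rising e t ⊆ σ} ⊆ T₁
  eq : T₂ = (T₁ \ projFace u '' {σ | σ.Nonempty ∧ σ ⊆ t ∧ ¬ rising e t ⊆ σ}) ∪
    projFace u '' {σ | σ.Nonempty ∧ σ ⊆ t ∧ ¬ rising (-e) t ⊆ σ}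

section Step

variable {u e : Space} {V t : Finset Space} {K : SimplicialComplex ℝ Space}

theorem mem_space_removeStar_iff {U σ : Finset Space} (hσ : σ ∈ K.faces) {x : Space}
    (hx : x ∈ openHull σ) : x ∈ (removeStar K U).space ↔ ¬ U ⊆ σ := by
  rw [SimplicialComplex.mem_space_iff]
  constructor
  · rintro ⟨s, ⟨hs, hU⟩, hxs⟩ h
    exact hU (h.trans (subset_of_mem_openHull hσ hs hx hxs))
  · exact fun h => ⟨σ, ⟨hσ, h⟩, openHull_subset _ hx⟩

theorem space_removeStar_subset {U : Finset Space} : (removeStar K U).space ⊆ K.space := by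
  intro x hx
  obtain ⟨s, hs, hxs⟩ := SimplicialComplex.mem_space_iff.1 hx
  exact SimplicialComplex.convexHull_subset_space hs.1 hxs

theorem IsTetrahedron.mem_convexHull_erase [DecidableEq Space] (ht : IsTetrahedron t) {x v : Space}
    (hv : v ∈ t) (hx : x ∈ convexHull ℝ (t : Set Space)) (h : coord t v x = 0) :
    x ∈ convexHull ℝ (t.erase v : Set Space) := by
  refine Finset.mem_convexHull'.2 ⟨fun w => coord t w x,
    fun w hw => ht.mem_convexHull_iff.1 hx w (Finset.mem_of_mem_erase hw), ?_, ?_⟩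
  · have := ht.sum_coord x
    rwa [← Finset.add_sum_erase _ _ hv, h, zero_add] at this
  · have := ht.sum_coord_smul x
    rwa [← Finset.add_sum_erase _ _ hv, h, zero_smul, zero_add] at this

/-- Below a point of an exposed tetrahedron `t` there are only points of `t`. -/
theorem Exposed.sub_smul_mem (h : Exposed e K t) (ht : t ∈ tetrahedra K) (he : e ≠ 0) {y : Space}
    (hy : y ∈ convexHull ℝ (t : Set Space)) {c : ℝ} (hc : 0 ≤ c) (hyc : y - c • e ∈ K.space) :
    y - c • e ∈ convexHull ℝ (t : Set Space) := by
  classical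
  have htt := isTetrahedron_of_mem ht
  -- The descending ray from `y` leaves `t` when the first rising coordinate reaches zero, through
  -- the facet opposite that vertex `v`.
  obtain ⟨v, hv, hmin⟩ := Finset.exists_min_image (rising e t)
    (fun v => coord t v y / slope e t v) (htt.rising_nonempty he)
  obtain ⟨hvt, hvs⟩ := mem_rising.1 hv
  have hy' := htt.mem_convexHull_iff.1 hy
  have key : ∀ d, 0 ≤ d → d ≤ coord t v y / slope e t v →
      y - d • e ∈ convexHull ℝ (t : Set Space) := by
    intro d hd hdv
    refine htt.mem_convexHull_iff.2 fun w hw => ?_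
    rw [sub_eq_add_neg, ← neg_smul, coord_add_smul]
    by_cases hwr : w ∈ rising e t
    · have h1 := (le_div_iff₀ (mem_rising.1 hwr).2).1 (hdv.trans (hmin w hwr))
      linarith
    · have h1 : slope e t w ≤ 0 := not_lt.1 fun h => hwr (mem_rising.2 ⟨hw, h⟩)
      have h2 := hy' w hw
      nlinarith
  refine key c hc ?_
  set d := coord t v y / slope e t v with hd
  have hz := key d (div_nonneg (hy' v hvt) hvs.le) le_rfl
  have hz0 : coord t v (y - d • e) = 0 := by
    rw [sub_eq_add_neg, ← neg_smul, coord_add_smul, hd]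
    field_simp
    ring
  -- The exit point lies on a lower facet, so `y - c • e` cannot be below it.
  have := h v hv _ (htt.mem_convexHull_erase hvt hz hz0) (d - c) (by
    convert hyc using 1
    module)
  linarith

variable (hV : GeneralPosition u V) (he : IsVertical u e)
  (hK : IsTriangulationBetweenSections u V K) (ht : t ∈ tetrahedra K) (h : Exposed e K t)
include hV he hK ht h

/-- Above a relative interior point of the falling set there are interior points of `t`. After a
perturbation a relative interior point of `σ` lies below a point of `t`, hence in `t`, since below
an exposed tetrahedron there is nothing else. -/
theorem Exposed.subset_of_rising_neg_subset {σ : Finset Space} (hσ : σ ∈ K.faces)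
    (hU : rising (-e) t ⊆ σ) : σ ⊆ t := by
  obtain ⟨y, hy⟩ := openHull_nonempty ((isTetrahedron_of_mem ht).rising_nonempty he.neg.ne_zero)
  obtain ⟨c, hc, hyc⟩ := exists_sub_mem_interior_of_rising hV he.neg hK ht (rising_subset _ t)
    subset_rfl hy
  have hyσ := convexHull_mono (Finset.coe_subset.2 hU) (openHull_subset _ hy)
  rw [sub_eq_add_neg, smul_neg, neg_neg] at hyc
  obtain ⟨y', hy', hyc'⟩ := exists_mem_openHull_perturb
    (SimplicialComplex.nonempty_of_mem_faces hσ) hyσ isOpen_interior hyc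
  have := h.sub_smul_mem ht he.ne_zero (interior_subset hyc') hc.le (by
    rw [add_sub_cancel_right]
    exact SimplicialComplex.convexHull_subset_space hσ (openHull_subset _ hy'))
  rw [add_sub_cancel_right] at this
  exact subset_of_mem_openHull hσ ht.1 hy' this

/-- Some interior point of `s` lies below a point of `t`, hence belongs to `t`. -/
theorem Exposed.eq_of_rising_subset {s : Finset Space} (hs : s ∈ tetrahedra K)
    (hst : rising e s ⊆ t) : s = t := by
  obtain ⟨y, hy⟩ := openHull_nonempty ((isTetrahedron_of_mem hs).rising_nonempty he.ne_zero)
  obtain ⟨c, hc, hyc⟩ := exists_sub_mem_interior_of_rising hV he hK hs (rising_subset _ s)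
    subset_rfl hy
  have hyt := convexHull_mono (Finset.coe_subset.2 hst) (openHull_subset _ hy)
  exact eq_of_mem_interior hs ht hyc (h.sub_smul_mem ht he.ne_zero hyt hc.le
    (tetrahedron_subset_space hs (interior_subset hyc)))

/-- If `x + c • e` were deleted, its carrier would be a face of `t` containing all falling vertices,
and `x` would lie in `t` too. As `x` survives, some falling coordinate is zero at `x`; it cannot
become positive on the way up. -/
theorem Exposed.add_smul_mem_space {x : Space} {c : ℝ}
    (hx : x ∈ (removeStar K (rising (-e) t)).space) (hc : 0 ≤ c) (hxc : x + c • e ∈ K.space) :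
    x + c • e ∈ (removeStar K (rising (-e) t)).space := by
  have htt := isTetrahedron_of_mem ht
  obtain ⟨σ, hσ, hxσ⟩ := exists_face_openHull hxc
  rw [mem_space_removeStar_iff hσ hxσ]
  intro hU
  have hσt := h.subset_of_rising_neg_subset hV he hK ht hσ hU
  have hxt := h.sub_smul_mem ht he.ne_zero
    (convexHull_mono (Finset.coe_subset.2 hσt) (openHull_subset _ hxσ)) hc (by
      rw [add_sub_cancel_right]
      exact space_removeStar_subset hx)
  rw [add_sub_cancel_right] at hxt
  obtain ⟨ρ, hρt, hne, hxρ⟩ := exists_mem_openHull hxt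
  obtain ⟨v, hv, hvρ⟩ := Finset.not_subset.1
    ((mem_space_removeStar_iff (K.down_closed ht.1 hρt hne) hxρ).1 hx)
  have h1 := htt.coord_eq_zero hρt (openHull_subset _ hxρ) (rising_subset _ _ hv) hvρ
  have h2 := htt.coord_pos hσt hxσ (hU hv)
  have h3 := (mem_rising.1 hv).2
  rw [coord_add_smul, h1] at h2
  rw [slope_neg] at h3
  nlinarith

/-- The highest point over each `p` survives, because a point carried by a deleted face can still
ascend within `t`. Vertical segments survive because the remaining space is closed under ascending
in `K`. -/
theorem Exposed.isTriangulationBetweenSections :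
    IsTriangulationBetweenSections u V (removeStar K (rising (-e) t)) where
  vertices_subset := fun v hv => hK.vertices_subset (SimplicialComplex.mem_vertices.2 hv.1)
  proj_space := by
    refine Set.Subset.antisymm ?_ fun p hp => ?_
    · rw [← hK.proj_space]
      exact Set.image_mono space_removeStar_subset
    · obtain ⟨x, hx, hxp, hmin⟩ := exists_lowest he.neg hK hp
      refine ⟨x, ?_, hxp⟩
      obtain ⟨σ, hσ, hxσ⟩ := exists_face_openHull hx
      rw [mem_space_removeStar_iff hσ hxσ]
      intro hU
      obtain ⟨c, hc, hxc⟩ := exists_sub_mem_interior_of_rising hV he.neg hK ht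
        (h.subset_of_rising_neg_subset hV he hK ht hσ hU) hU hxσ
      have := hmin (-c) (by
        rw [neg_smul, ← sub_eq_add_neg]
        exact tetrahedron_subset_space ht (interior_subset hxc))
      linarith
  segment_subset x hx y hy hxy := by
    rintro z hz
    have hzK := hK.segment_subset x (space_removeStar_subset hx) y (space_removeStar_subset hy)
      hxy hz
    obtain ⟨c, rfl⟩ := he.exists_eq_add_smul hxy.symm
    obtain ⟨a, b, ha, hb, hab, rfl⟩ := hz
    have e1 : a • x + b • (x + c • e) = x + (b * c) • e := by
      obtain rfl : a = 1 - b := by linarith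
      module
    have e2 : a • x + b • (x + c • e) = x + c • e + (-(a * c)) • e := by
      obtain rfl : a = 1 - b := by linarith
      module
    -- The segment is traversed upwards from its lower end, which is `x` or `x + c • e` according to
    -- the sign of `c`.
    rcases le_total 0 c with hc | hc
    · rw [e1] at hzK ⊢
      exact h.add_smul_mem_space hV he hK ht hx (mul_nonneg hb hc) hzK
    · rw [e2] at hzK ⊢
      exact h.add_smul_mem_space hV he hK ht hy (by nlinarith) hzK

theorem Exposed.tetrahedra_removeStar :
    tetrahedra (removeStar K (rising (-e) t)) = tetrahedra K \ {t} := by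
  ext s
  constructor
  · rintro ⟨⟨hs, hU⟩, hc⟩
    refine ⟨⟨hs, hc⟩, ?_⟩
    rintro rfl
    exact hU (rising_subset _ _)
  · rintro ⟨hs, hst⟩
    refine ⟨⟨hs.1, fun hU => hst ?_⟩, hs.2⟩
    exact Finset.eq_of_subset_of_card_le (h.subset_of_rising_neg_subset hV he hK ht hs.1 hU)
      (ht.2.trans hs.2.symm).le

/-- The deleted faces contain the falling set of `t`, so none is upper. For the surviving faces the
test against `t` is satisfied anyway. -/
theorem Exposed.lowerTri_neg_removeStar :
    lowerTri u (-e) (removeStar K (rising (-e) t)) = lowerTri u (-e) K := by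
  have hK' := h.isTriangulationBetweenSections hV he hK ht
  refine congrArg (projFace u '' ·) (Set.ext fun σ => ?_)
  constructor
  · rintro ⟨hσ, hl⟩
    refine ⟨hσ.1, (lower_iff hV he.neg hK hσ.1).2 fun s hs => ?_⟩
    rw [lower_iff hV he.neg hK' hσ, h.tetrahedra_removeStar hV he hK ht] at hl
    by_cases hst : s = t
    · exact hst ▸ hσ.2
    · exact hl s ⟨hs, hst⟩
  · rintro ⟨hσ, hl⟩
    rw [lower_iff hV he.neg hK hσ] at hl
    refine ⟨⟨hσ, hl t ht⟩, (lower_iff hV he.neg hK' ⟨hσ, hl t ht⟩).2 fun s hs => hl s ?_⟩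
    rw [h.tetrahedra_removeStar hV he hK ht] at hs
    exact hs.1

/-- Outside `t` nothing changes, since a face hidden by `t` alone would be contained in `t`. Inside
`t` every surviving face becomes lower, since no other tetrahedron has its rising set in `t`. -/
theorem Exposed.lower_removeStar_iff (σ : Finset Space) :
    (σ ∈ (removeStar K (rising (-e) t)).faces ∧
        Lower e (removeStar K (rising (-e) t)).space σ) ↔
      (σ ∈ K.faces ∧ Lower e K.space σ ∧ ¬ σ ⊆ t) ∨
        (σ.Nonempty ∧ σ ⊆ t ∧ ¬ rising (-e) t ⊆ σ) := by
  have hK' := h.isTriangulationBetweenSections hV he hK ht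
  have hT := h.tetrahedra_removeStar hV he hK ht
  constructor
  · rintro ⟨hσ, hl⟩
    rw [lower_iff hV he hK' hσ, hT] at hl
    by_cases hσt : σ ⊆ t
    · exact Or.inr ⟨SimplicialComplex.nonempty_of_mem_faces hσ, hσt, hσ.2⟩
    · refine Or.inl ⟨hσ.1, (lower_iff hV he hK hσ.1).2 fun s hs hr => ?_, hσt⟩
      -- Replace `s` by a tetrahedron containing `σ`, which cannot be `t` as `σ` is not a face of
      -- `t`.
      obtain ⟨s', hs', hr', hσs⟩ := exists_rising_subset_subset hV he hK hs hσ.1 hr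
      exact hl s' ⟨hs', fun h => hσt (h ▸ hσs)⟩ hr'
  · rintro (⟨hσ, hl, hσt⟩ | ⟨hne, hσt, hU⟩)
    · have hσ' : σ ∈ (removeStar K (rising (-e) t)).faces :=
        ⟨hσ, fun hU => hσt (h.subset_of_rising_neg_subset hV he hK ht hσ hU)⟩
      rw [lower_iff hV he hK hσ] at hl
      refine ⟨hσ', (lower_iff hV he hK' hσ').2 fun s hs => hl s ?_⟩
      rw [hT] at hs
      exact hs.1
    · have hσ' : σ ∈ (removeStar K (rising (-e) t)).faces := ⟨K.down_closed ht.1 hσt hne, hU⟩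
      refine ⟨hσ', (lower_iff hV he hK' hσ').2 fun s hs hr => ?_⟩
      rw [hT] at hs
      exact hs.2 (h.eq_of_rising_subset hV he hK ht hs.1 (hr.trans hσt))

theorem Exposed.lower_face_iff {σ : Finset Space} (hσ : σ ⊆ t) :
    (σ ∈ K.faces ∧ Lower e K.space σ) ↔ σ.Nonempty ∧ ¬ rising e t ⊆ σ := by
  constructor
  · rintro ⟨hf, hl⟩
    exact ⟨SimplicialComplex.nonempty_of_mem_faces hf, (lower_iff hV he hK hf).1 hl t ht⟩
  · rintro ⟨hne, hr⟩
    exact ⟨K.down_closed ht.1 hσ hne, h.lower hσ hr⟩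

omit h in
theorem eq_of_rising_subset_of_rising_neg_subset {σ : Finset Space} (hσ : σ ⊆ t) (hW : rising e t ⊆ σ)
    (hU : rising (-e) t ⊆ σ) : σ = t := by
  classical
  refine hσ.antisymm ?_
  rw [← Finset.sdiff_union_of_subset (rising_subset e t),
    ← hV.rising_neg_eq he (isTetrahedron_of_mem ht) (hK.face_subset ht.1)]
  exact Finset.union_subset hU hW

theorem Exposed.projFace_mem_removeStar_iff {σ : Finset Space} (hσ : σ ⊆ V) :
    projFace u σ ∈ lowerTri u e (removeStar K (rising (-e) t)) ↔
      (projFace u σ ∈ lowerTri u e K ∧ ¬ σ ⊆ t) ∨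
        (σ.Nonempty ∧ σ ⊆ t ∧ ¬ rising (-e) t ⊆ σ) := by
  rw [projFace_mem_lowerTri hV (h.isTriangulationBetweenSections hV he hK ht) hσ,
    projFace_mem_lowerTri hV hK hσ, h.lower_removeStar_iff hV he hK ht, and_assoc]

theorem Exposed.isFlip :
    IsFlip u e V t (lowerTri u e K) (lowerTri u e (removeStar K (rising (-e) t))) := by
  have hK' := h.isTriangulationBetweenSections hV he hK ht
  have htV := hK.face_subset ht.1
  have himage : ∀ {σ : Finset Space} {P : Finset Space → Prop}, σ ⊆ V →
      (projFace u σ ∈ projFace u '' {σ | σ.Nonempty ∧ σ ⊆ t ∧ P σ} ↔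
        σ.Nonempty ∧ σ ⊆ t ∧ P σ) := by
    intro σ P hσ
    constructor
    · rintro ⟨τ, hτ, hτσ⟩
      exact (projFace_eq_projFace hV (hτ.2.1.trans htV) hσ).1 hτσ ▸ hτ
    · exact fun hσ => ⟨σ, hσ, rfl⟩
  refine ⟨isTriangulation_lowerTri hV he hK, isTriangulation_lowerTri hV he hK', htV,
    isTetrahedron_of_mem ht, ?_, ?_⟩
  · rintro _ ⟨σ, ⟨hne, hσ, hr⟩, rfl⟩
    exact ⟨σ, (h.lower_face_iff hV he hK ht hσ).2 ⟨hne, hr⟩, rfl⟩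
  · have key : ∀ σ ⊆ V, (projFace u σ ∈ lowerTri u e (removeStar K (rising (-e) t)) ↔
        projFace u σ ∈ (lowerTri u e K \
          projFace u '' {σ | σ.Nonempty ∧ σ ⊆ t ∧ ¬ rising e t ⊆ σ}) ∪
          projFace u '' {σ | σ.Nonempty ∧ σ ⊆ t ∧ ¬ rising (-e) t ⊆ σ}) := by
      intro σ hσ
      rw [h.projFace_mem_removeStar_iff hV he hK ht hσ, Set.mem_union, Set.mem_sdiff, himage hσ,
        himage hσ]
      refine or_congr_left (and_congr_right fun hm => not_congr ⟨fun hσt => ?_, fun h => h.2.1⟩)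
      have := (h.lower_face_iff hV he hK ht hσt).1 ((projFace_mem_lowerTri hV hK hσ).1 hm)
      exact ⟨this.1, hσt, this.2⟩
    ext ρ
    constructor
    · rintro ⟨σ, hσ, rfl⟩
      exact (key σ (hK'.face_subset hσ.1)).1 ⟨σ, hσ, rfl⟩
    · intro hρ
      obtain ⟨σ, hσ, rfl⟩ : ∃ σ ⊆ V, projFace u σ = ρ := by
        rcases hρ with ⟨⟨σ, hσ, rfl⟩, -⟩ | ⟨σ, hσ, rfl⟩
        · exact ⟨σ, hK.face_subset hσ.1, rfl⟩
        · exact ⟨σ, hσ.2.1.trans htV, rfl⟩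
      exact (key σ hσ).2 hρ

/-- The faces of `t` containing neither the rising nor the falling set are lower and upper at once.
Exchanging only the faces through the falling set for those through the rising set therefore has the
same effect as exchanging all lower faces for all upper ones. -/
theorem Exposed.performFlip_eq :
    performFlip (lowerTri u e K) (projFace u (rising (-e) t)) (projFace u (rising e t)) =
      lowerTri u e (removeStar K (rising (-e) t)) := by
  classical
  have hK' := h.isTriangulationBetweenSections hV he hK ht
  have htV := hK.face_subset ht.1
  have htt := isTetrahedron_of_mem ht
  have hunion : projFace u (rising (-e) t) ∪ projFace u (rising e t) = projFace u t := by
    have himage : projFace u (rising (-e) t ∪ rising e t) =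
        projFace u (rising (-e) t) ∪ projFace u (rising e t) :=
      Finset.image_union (f := proj u) _ _
    rw [← himage, hV.rising_neg_eq he htt htV, Finset.sdiff_union_of_subset (rising_subset e t)]
  have hsub : ∀ {σ τ : Finset Space}, σ ⊆ V → τ ⊆ V →
      (projFace u σ ⊆ projFace u τ ↔ σ ⊆ τ) := fun hσ hτ => hV.projFace_subset_iff hσ hτ
  have key : ∀ σ ⊆ V, (projFace u σ ∈
      performFlip (lowerTri u e K) (projFace u (rising (-e) t)) (projFace u (rising e t)) ↔
        projFace u σ ∈ lowerTri u e (removeStar K (rising (-e) t))) := by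
    intro σ hσ
    rw [h.projFace_mem_removeStar_iff hV he hK ht hσ, performFlip, Set.mem_union, Set.mem_sdiff,
      Set.mem_ofPred_eq, Set.mem_ofPred_eq, hunion, ssubset_iff_subset_not_subset, hsub hσ htV,
      hsub htV hσ, hsub ((rising_subset _ t).trans htV) hσ,
      hsub ((rising_subset _ t).trans htV) hσ]
    by_cases hσt : σ ⊆ t
    · rw [projFace_mem_lowerTri hV hK hσ, h.lower_face_iff hV he hK ht hσt]
      have h1 : t ⊆ σ → rising e t ⊆ σ := (rising_subset e t).trans
      have h2 : t ⊆ σ → rising (-e) t ⊆ σ := (rising_subset (-e) t).trans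
      have h3 : rising e t ⊆ σ → rising (-e) t ⊆ σ → t ⊆ σ := fun hW hU =>
        (eq_of_rising_subset_of_rising_neg_subset hV he hK ht hσt hW hU).ge
      have h4 : rising e t ⊆ σ → σ.Nonempty := (htt.rising_nonempty he.ne_zero).mono
      tauto
    · simp [hσt]
  ext ρ
  constructor
  · intro hρ
    obtain ⟨σ, hσ, rfl⟩ : ∃ σ ⊆ V, projFace u σ = ρ := by
      rcases hρ with ⟨⟨σ, hσ, rfl⟩, -⟩ | ⟨-, hρ⟩
      · exact ⟨σ, hK.face_subset hσ.1, rfl⟩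
      · rw [hunion] at hρ
        obtain ⟨σ, hσ, h⟩ := Finset.subset_image_iff.1 hρ.1
        exact ⟨σ, (Finset.coe_subset.1 hσ).trans htV, h⟩
    exact (key σ hσ).1 hρ
  · rintro ⟨σ, hσ, rfl⟩
    exact (key σ (hK'.face_subset hσ.1)).2 ⟨σ, hσ, rfl⟩

end Step

/-! ### Correctness of the algorithm -/

/-- Some ray in direction `e` first passes through the interior of `s` and then through the interior
of `t`. -/
def InFrontAlong (e : Space) (s t : Finset Space) : Prop :=
  ∃ x ∈ interior (convexHull ℝ (s : Set Space)), ∃ c : ℝ, 0 < c ∧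
    x + c • e ∈ interior (convexHull ℝ (t : Set Space))

/-- The tetrahedra of `K` form no cycle with respect to `InFrontAlong e`. -/
def AcyclicAlong (e : Space) (K : SimplicialComplex ℝ Space) : Prop :=
  ∀ t, ¬ Relation.TransGen
    (fun a b => a ∈ tetrahedra K ∧ b ∈ tetrahedra K ∧ a ≠ b ∧ InFrontAlong e a b) t t

theorem AcyclicAlong.mono {e : Space} {K K' : SimplicialComplex ℝ Space} (h : AcyclicAlong e K)
    (hT : tetrahedra K' ⊆ tetrahedra K) : AcyclicAlong e K' :=
  fun t ht => h t (ht.lift id fun _ _ hab => ⟨hT hab.1, hT hab.2.1, hab.2.2⟩)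

/-- The transitive closure is a strict order, hence well-founded on a finite set. -/
theorem exists_minimal_of_acyclic {α : Type*} {r : α → α → Prop}
    (h : ∀ a, ¬ Relation.TransGen r a a) {S : Set α} (hS : S.Finite) (hne : S.Nonempty) :
    ∃ a ∈ S, ∀ b ∈ S, ¬ r b a := by
  have : IsStrictOrder α (Relation.TransGen r) :=
    { irrefl := h, trans := fun _ _ _ => Relation.TransGen.trans }
  have hwf : S.WellFoundedOn (Relation.TransGen r) := hS.wellFoundedOn
  obtain ⟨x, hx⟩ := hne
  obtain ⟨a, -, ha⟩ := WellFounded.has_min hwf Set.univ ⟨⟨x, hx⟩, trivial⟩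
  exact ⟨a, a.2, fun b hb hr => ha ⟨b, hb⟩ trivial (Relation.TransGen.single hr)⟩

/-- Take `t` with no tetrahedron in front of it. If its facet opposite a rising vertex were not
lower, the rising set of some `s` would lie in that facet, with interior points of `s` just below
it, so `s` would be in front of `t`. -/
theorem AcyclicAlong.exists_exposed {u e : Space} {V : Finset Space}
    {K : SimplicialComplex ℝ Space} (hV : GeneralPosition u V) (he : IsVertical u e)
    (hK : IsTriangulationBetweenSections u V K) (h : AcyclicAlong e K)
    (hne : (tetrahedra K).Nonempty) : ∃ t ∈ tetrahedra K, Exposed e K t := by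
  classical
  obtain ⟨t, ht, hmin⟩ := exists_minimal_of_acyclic h
    (hK.finite_faces.subset fun _ ht => ht.1) hne
  have htt := isTetrahedron_of_mem ht
  refine ⟨t, ht, fun v hv => ?_⟩
  have hvt := rising_subset e t hv
  have hface : t.erase v ∈ K.faces := K.down_closed ht.1 (Finset.erase_subset v t) (by
    rw [← Finset.card_pos, Finset.card_erase_of_mem hvt, ht.2]
    norm_num)
  refine (lower_iff hV he hK hface).2 fun s hs hr => hmin s hs ⟨hs, ht, ?_, ?_⟩
  · rintro rfl
    exact Finset.notMem_erase v s (hr hv)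
  · obtain ⟨y, hy⟩ := openHull_nonempty ((isTetrahedron_of_mem hs).rising_nonempty he.ne_zero)
    obtain ⟨c, hc, hyc⟩ := exists_sub_mem_interior_of_rising hV he hK hs (rising_subset _ s)
      subset_rfl hy
    have hyt := convexHull_mono (Finset.coe_subset.2 (hr.trans (Finset.erase_subset v t)))
      (openHull_subset _ hy)
    rw [sub_eq_add_neg] at hyc
    -- The point `y` is on the boundary of `t`; pushing it into the interior keeps the point below
    -- it in the interior of `s`.
    obtain ⟨y', hy', hyc'⟩ := exists_mem_openHull_perturb
      (SimplicialComplex.nonempty_of_mem_faces ht.1) hyt isOpen_interior hyc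
    refine ⟨_, hyc', c, hc, ?_⟩
    rw [neg_add_cancel_right]
    exact htt.mem_interior_iff.2 fun w hw => htt.coord_pos subset_rfl hy' hw

theorem FlipSequence.concat {u : Space}
    {R : Finset Space → Set (Finset (Plane u)) → Set (Finset (Plane u)) → Prop}
    {T₁ T₂ T₃ : Set (Finset (Plane u))} {L : List (Finset Space)} {t : Finset Space}
    (h : FlipSequence R T₁ L T₂) (ht : R t T₂ T₃) : FlipSequence R T₁ (L ++ [t]) T₃ := by
  induction h with
  | nil T => exact .cons _ _ _ _ _ ht (.nil _)
  | cons s L T₁ T₂ T₃' hs _ ih => exact .cons _ _ _ _ _ hs (ih ht)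

/-- The invariant of the algorithm: the remaining tetrahedra are those of a complex `K'` between
sections with the same upper side as `K`, and the current triangulation is the projection of its
lower side. -/
structure Invariant (u e : Space) (V : Finset Space)
    (R : Finset Space → Set (Finset (Plane u)) → Set (Finset (Plane u)) → Prop)
    (K : SimplicialComplex ℝ Space) (s : State u) (K' : SimplicialComplex ℝ Space) : Prop where
  sections : IsTriangulationBetweenSections u V K'
  acyclic : AcyclicAlong e K'
  tri : s.tri = lowerTri u e K'
  queue : s.queue = tetrahedra K'
  subset : tetrahedra K' ⊆ tetrahedra K
  upper : lowerTri u (-e) K' = lowerTri u (-e) K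
  nodup : s.out.Nodup
  mem_out : ∀ t, t ∈ s.out ↔ t ∈ tetrahedra K ∧ t ∉ s.queue
  sequence : FlipSequence R (lowerTri u e K) s.out s.tri

section Algorithm

variable {u e : Space} {V : Finset Space} {K K' : SimplicialComplex ℝ Space}
  {R : Finset Space → Set (Finset (Plane u)) → Set (Finset (Plane u)) → Prop}

theorem Invariant.initial (hK : IsTriangulationBetweenSections u V K) (h : AcyclicAlong e K) :
    Invariant u e V R K (initialState K (lowerTri u e K)) K :=
  ⟨hK, h, rfl, rfl, subset_rfl, rfl, List.nodup_nil, fun t => by simp [initialState], .nil _⟩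

variable (hu : u ≠ 0) (hV : GeneralPosition u V) (he : IsVertical u e)
  (hR : ∀ t T₁ T₂, IsFlip u e V t T₁ T₂ → R t T₁ T₂)
include hu hV he hR

/-- A removable tetrahedron is exposed in `K'`, so its flip amounts to passing to `removeStar`. An
idle iteration is impossible, since acyclicity supplies an exposed, hence removable, tetrahedron
while the queue is nonempty. -/
theorem Invariant.iteration {s s' : State u} (h : Invariant u e V R K s K')
    (hs : Iteration s s') :
    (∃ K'', Invariant u e V R K s' K'') ∧ s'.queue.ncard < s.queue.ncard := by
  have hK' := h.sections
  have hfin : (tetrahedra K').Finite := hK'.finite_faces.subset fun _ ht => ht.1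
  cases hs with
  | flip t U W ht hrem =>
    have ht' : t ∈ tetrahedra K' := h.queue ▸ ht
    rw [h.tri] at hrem
    obtain ⟨hexp, rfl, rfl⟩ := hrem.exposed hV he hK' ht'
    have htri : performFlip s.tri (projFace u (rising (-e) t)) (projFace u (rising e t)) =
        lowerTri u e (removeStar K' (rising (-e) t)) := by
      rw [h.tri, hexp.performFlip_eq hV he hK' ht']
    have hT := hexp.tetrahedra_removeStar hV he hK' ht'
    have hTsub : tetrahedra (removeStar K' (rising (-e) t)) ⊆ tetrahedra K' := by
      rw [hT]
      exact Set.sdiff_subset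
    refine ⟨⟨removeStar K' (rising (-e) t), ?_, h.acyclic.mono hTsub, htri, ?_,
      hTsub.trans h.subset, ?_, ?_, ?_, ?_⟩, ?_⟩
    · exact hexp.isTriangulationBetweenSections hV he hK' ht'
    · change s.queue \ {t} = _
      rw [h.queue, hT]
    · rw [hexp.lowerTri_neg_removeStar hV he hK' ht', h.upper]
    · change (s.out ++ [t]).Nodup
      refine h.nodup.append (List.nodup_singleton t) ?_
      rw [List.disjoint_singleton]
      exact fun hmem => ((h.mem_out t).1 hmem).2 ht
    · intro a
      change a ∈ s.out ++ [t] ↔ a ∈ tetrahedra K ∧ a ∉ s.queue \ {t}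
      rw [List.mem_append, List.mem_singleton, h.mem_out, Set.mem_sdiff, Set.mem_singleton_iff]
      have h1 : a = t → a ∈ tetrahedra K := fun h' => h' ▸ h.subset ht'
      tauto
    · refine h.sequence.concat (hR _ _ _ ?_)
      change IsFlip u e V t s.tri (performFlip s.tri _ _)
      rw [htri, h.tri]
      exact hexp.isFlip hV he hK' ht'
    · exact Set.ncard_sdiff_singleton_lt_of_mem ht (h.queue ▸ hfin)
  | idle hne hidle =>
    rw [h.queue] at hne hidle
    obtain ⟨t, ht, hexp⟩ := h.acyclic.exists_exposed hV he hK' hne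
    refine absurd (hexp.removableBy hV he hK' hu ht) ?_
    rw [← h.tri]
    exact hidle t ht _ _

theorem algorithmSucceeds (hK : IsTriangulationBetweenSections u V K) (h : AcyclicAlong e K) :
    AlgorithmSucceeds R K (lowerTri u e K) (lowerTri u (-e) K) := by
  refine ⟨?_, ?_⟩
  · rintro ⟨f, h0, hf⟩
    have hinv : ∀ n, ∃ K', Invariant u e V R K (f n) K' := by
      intro n
      induction n with
      | zero => exact ⟨K, h0 ▸ Invariant.initial hK h⟩
      | succ n ih =>
        obtain ⟨K', hK'⟩ := ih
        exact (hK'.iteration hu hV he hR (hf n)).1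
    -- Each iteration shrinks the finite queue, so an infinite run would exceed its initial size.
    have hlt : ∀ n, (f n).queue.ncard + n ≤ (f 0).queue.ncard := by
      intro n
      induction n with
      | zero => exact le_rfl
      | succ n ih =>
        obtain ⟨K', hK'⟩ := hinv n
        have := (hK'.iteration hu hV he hR (hf n)).2
        omega
    have := hlt ((f 0).queue.ncard + 1)
    omega
  · rintro s ⟨hreach, hempty⟩
    have hinv : ∃ K', Invariant u e V R K s K' := by
      clear hempty
      induction hreach with
      | refl => exact ⟨K, Invariant.initial hK h⟩
      | tail _ hstep ih =>
        obtain ⟨K', hK'⟩ := ih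
        exact (hK'.iteration hu hV he hR hstep).1
    obtain ⟨K', hK'⟩ := hinv
    have hT : tetrahedra K' = ∅ := by rw [← hK'.queue, hempty]
    have htri : s.tri = lowerTri u (-e) K := by
      rw [hK'.tri, ← hK'.upper]
      -- Without tetrahedra the criterion of `lower_iff` is vacuous for both `e` and `-e`, so lower
      -- and upper faces are the same.
      refine congrArg (projFace u '' ·) (Set.ext fun σ => and_congr_right fun hσ => ?_)
      rw [lower_iff hV he hK'.sections hσ, lower_iff hV he.neg hK'.sections hσ, hT]
      simp
    refine ⟨htri, hK'.nodup, fun t => ?_, htri ▸ hK'.sequence⟩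
    rw [hK'.mem_out, hempty]
    simp

end Algorithm

/-! ### Upward and downward direction -/

theorem height_add_smul {u : Space} (hu : u ≠ 0) (x : Space) (c : ℝ) :
    height u (x + c • u) = height u x + c * ‖u‖ := by
  have hn : ‖u‖ ≠ 0 := norm_ne_zero_iff.2 hu
  rw [height, height, inner_add_right, inner_smul_right, real_inner_self_eq_norm_sq]
  field_simp

theorem onLowerSide_iff {u : Space} (hu : u ≠ 0) {P : Set Space} {σ : Finset Space} :
    OnLowerSide u P σ ↔ Lower u P σ := by
  have hn : 0 < ‖u‖ := norm_pos_iff.2 hu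
  have he := isVertical_self hu
  constructor
  · intro h x hx c hc
    have := h x hx _ hc (he.proj_add_smul x c)
    rw [height_add_smul hu] at this
    exact nonneg_of_mul_nonneg_left (by linarith) hn
  · intro h x hx y hy hxy
    obtain ⟨c, rfl⟩ := he.exists_eq_add_smul hxy
    rw [height_add_smul hu]
    have := mul_nonneg (h x hx c hy) hn.le
    linarith

theorem onUpperSide_iff {u : Space} (hu : u ≠ 0) {P : Set Space} {σ : Finset Space} :
    OnUpperSide u P σ ↔ Lower (-u) P σ := by
  have hn : 0 < ‖u‖ := norm_pos_iff.2 hu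
  have he := isVertical_self hu
  constructor
  · intro h x hx c hc
    rw [smul_neg, ← neg_smul] at hc
    have := h x hx _ hc (he.proj_add_smul x _)
    rw [height_add_smul hu] at this
    exact nonneg_of_mul_nonneg_left (by linarith) hn
  · intro h x hx y hy hxy
    obtain ⟨c, rfl⟩ := he.exists_eq_add_smul hxy
    rw [height_add_smul hu]
    have := mul_nonneg (h x hx (-c) (by rwa [smul_neg, neg_smul, neg_neg])) hn.le
    linarith

theorem inFront_iff {u : Space} (hu : u ≠ 0) {s t : Finset Space} :
    InFront u s t ↔ InFrontAlong u s t := by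
  have hn : 0 < ‖u‖ := norm_pos_iff.2 hu
  have he := isVertical_self hu
  constructor
  · rintro ⟨x, hx, y, hy, hxy, hlt⟩
    obtain ⟨c, rfl⟩ := he.exists_eq_add_smul hxy.symm
    rw [height_add_smul hu] at hlt
    exact ⟨x, hx, c, pos_of_mul_pos_left (by linarith) hn.le, hy⟩
  · rintro ⟨x, hx, c, hc, hy⟩
    refine ⟨x, hx, _, hy, (he.proj_add_smul x c).symm, ?_⟩
    rw [height_add_smul hu]
    have := mul_pos hc hn
    linarith

theorem inFrontAlong_neg_iff {e : Space} {s t : Finset Space} :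
    InFrontAlong (-e) s t ↔ InFrontAlong e t s := by
  constructor
  · rintro ⟨x, hx, c, hc, hy⟩
    exact ⟨_, hy, c, hc, by simpa using hx⟩
  · rintro ⟨x, hx, c, hc, hy⟩
    exact ⟨_, hy, c, hc, by simpa using hx⟩

theorem AcyclicFrom.acyclicAlong {u : Space} (hu : u ≠ 0) {K : SimplicialComplex ℝ Space}
    (h : AcyclicFrom u K) : AcyclicAlong u K := by
  intro t ht
  refine h t (ht.lift id ?_)
  rintro a b ⟨ha, hb, hab, hf⟩
  exact ⟨ha, hb, hab, (inFront_iff hu).2 hf⟩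

/-- Reversing the direction reverses the relation, and a reversed cycle is a cycle. -/
theorem AcyclicAlong.neg {e : Space} {K : SimplicialComplex ℝ Space} (h : AcyclicAlong e K) :
    AcyclicAlong (-e) K := by
  intro t ht
  refine h t (Relation.transGen_swap.1 (ht.lift id ?_))
  rintro a b ⟨ha, hb, hab, hf⟩
  exact ⟨hb, ha, hab.symm, inFrontAlong_neg_iff.1 hf⟩

theorem lowerTriangulation_eq {u : Space} (hu : u ≠ 0) (K : SimplicialComplex ℝ Space) :
    lowerTriangulation u K = lowerTri u u K := by
  simp only [lowerTriangulation, lowerTri, onLowerSide_iff hu]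

theorem upperTriangulation_eq {u : Space} (hu : u ≠ 0) (K : SimplicialComplex ℝ Space) :
    upperTriangulation u K = lowerTri u (-u) K := by
  simp only [upperTriangulation, lowerTri, onUpperSide_iff hu]

section Faces

variable {u : Space} {V t : Finset Space} (hu : u ≠ 0) (hV : GeneralPosition u V)
  (ht : IsTetrahedron t) (htV : t ⊆ V)
include hu hV ht htV

theorem lowerFaces_eq :
    lowerFaces u t = projFace u '' {σ | σ.Nonempty ∧ σ ⊆ t ∧ ¬ rising u t ⊆ σ} := by
  refine congrArg (projFace u '' ·) (Set.ext fun σ => and_congr_right fun _ =>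
    and_congr_right fun hσ => ?_)
  rw [onLowerSide_iff hu, hV.lower_tetrahedron_iff (isVertical_self hu) ht htV hσ]

theorem upperFaces_eq :
    upperFaces u t = projFace u '' {σ | σ.Nonempty ∧ σ ⊆ t ∧ ¬ rising (-u) t ⊆ σ} := by
  refine congrArg (projFace u '' ·) (Set.ext fun σ => and_congr_right fun _ =>
    and_congr_right fun hσ => ?_)
  rw [onUpperSide_iff hu, hV.lower_tetrahedron_iff (isVertical_self hu).neg ht htV hσ]

end Faces

theorem IsFlip.isUpFlip {u : Space} {V t : Finset Space} (hu : u ≠ 0) (hV : GeneralPosition u V)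
    {T₁ T₂ : Set (Finset (Plane u))} (h : IsFlip u u V t T₁ T₂) : IsUpFlip u V t T₁ T₂ := by
  have hl := lowerFaces_eq hu hV h.isTetrahedron h.subset
  have hr := upperFaces_eq hu hV h.isTetrahedron h.subset
  exact ⟨h.left, h.right, h.subset, h.isTetrahedron.card, h.isTetrahedron.indep, hl ▸ h.lower,
    by rw [hl, hr]; exact h.eq⟩

theorem IsFlip.isDownFlip {u : Space} {V t : Finset Space} (hu : u ≠ 0) (hV : GeneralPosition u V)
    {T₁ T₂ : Set (Finset (Plane u))} (h : IsFlip u (-u) V t T₁ T₂) : IsDownFlip u V t T₁ T₂ := by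
  have hl := lowerFaces_eq hu hV h.isTetrahedron h.subset
  have hr := upperFaces_eq hu hV h.isTetrahedron h.subset
  have heq := h.eq
  rw [neg_neg] at heq
  exact ⟨h.left, h.right, h.subset, h.isTetrahedron.card, h.isTetrahedron.indep, hr ▸ h.lower,
    by rw [hl, hr]; exact heq⟩

end FlipAlg

theorem mainTheorem7 (u : FlipAlg.Space) (hu : u ≠ 0) (V : Finset FlipAlg.Space)
    (hV : FlipAlg.GeneralPosition u V)
    (K : Geometry.SimplicialComplex ℝ FlipAlg.Space)
    (hK : FlipAlg.IsTriangulationBetweenSections u V K)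
    (hacyclic : FlipAlg.AcyclicFrom u K) :
    FlipAlg.IsTriangulation (FlipAlg.shadow u V) (FlipAlg.lowerTriangulation u K) ∧
    FlipAlg.IsTriangulation (FlipAlg.shadow u V) (FlipAlg.upperTriangulation u K) ∧
    FlipAlg.AlgorithmSucceeds (FlipAlg.IsUpFlip u V) K
      (FlipAlg.lowerTriangulation u K) (FlipAlg.upperTriangulation u K) ∧
    FlipAlg.AlgorithmSucceeds (FlipAlg.IsDownFlip u V) K
      (FlipAlg.upperTriangulation u K) (FlipAlg.lowerTriangulation u K) := by
  have he := FlipAlg.isVertical_self hu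
  have hac := hacyclic.acyclicAlong hu
  -- Down-flips are the flips for the direction `-u`, in which lower and upper sides exchange roles.
  have hdown := FlipAlg.algorithmSucceeds hu hV he.neg
    (fun t T₁ T₂ h => FlipAlg.IsFlip.isDownFlip hu hV h) hK hac.neg
  rw [neg_neg] at hdown
  rw [FlipAlg.lowerTriangulation_eq hu, FlipAlg.upperTriangulation_eq hu]
  exact ⟨FlipAlg.isTriangulation_lowerTri hV he hK, FlipAlg.isTriangulation_lowerTri hV he.neg hK,
    FlipAlg.algorithmSucceeds hu hV he (fun t T₁ T₂ h => FlipAlg.IsFlip.isUpFlip hu hV h) hK hac,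
    hdown⟩
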